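/- All C$^*$-algebras are complex and not assumed unital; for a C$^*$-algebra $B$ let $\tilde B$ be the unitization, in which a new unit $\mathbb 1$ is always added. Let $\mathcal P$ be the universal C$^*$-algebra on generators $h,k,x$ subject to the relations $$hk=0,\qquad 0\le P\le 1\ \text{ in } \mathbf M_2(\tilde{\mathcal P}),\qquad P=\begin{pmatrix}\mathbb 1-h & x^*\\ x& k\end{pmatrix}.$$ Let $\mathbb C\ast C_0(0,1]$ be the (non-unital) free product, that is, the coproduct of C$^*$-algebras; let $p$ be the projection in it that is the image of $1\in\mathbb C$, and $l$ the positive contraction in it that is the image of the function $t\mapsto t$ in $C_0(0,1]$. **Theorem.** There is a unique $*$-homomorphism $\theta:\mathcal P\to\mathbb C\ast C_0(0,1]$ with $$\theta(h)=p-plp,\qquad \theta(k)=(\mathbb 1-p)\,l\,(\mathbb 1-p),\qquad \theta(x)=(\mathbb 1-p)\,l\,p,$$ and a unique $*$-homomorphism $\rho:\mathbb C\ast C_0(0,1]\to\mathbb C$ with $\rho(p)=\rho(l)=1$. The sequence $$0\longrightarrow\mathcal P\xrightarrow{\ \theta\ }\mathbb C\ast C_0(0,1]\xrightarrow{\ \rho\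 }\mathbb C\longrightarrow0$$ is exact: $\theta$ is injective, the range of $\theta$ equals the kernel of $\rho$, and $\rho$ is surjective. In particular $\theta$ embeds $\mathcal P$ as a closed two-sided ideal of $\mathbb C\ast C_0(0,1]$. -/

import Mathlib

open scoped ENNReal CStarAlgebra ZeroAtInfty

universe u v w

section Small

/-- Formal `*`-algebra expressions over a set of generators. -/
inductive StarExpr (G : Type u) : Type u
  | gen (g : G)
  | zero
  | add (s t : StarExpr G)
  | smul (c : ℂ) (s : StarExpr G)
  | mul (s t : StarExpr G)
  | star (s : StarExpr G)

variable {G : Type u} {B : Type v} [NonUnitalCStarAlgebra B]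

/-- The value of a formal expression at an assignment of the generators. -/
def StarExpr.eval (f : G → B) : StarExpr G → B
  | gen g => f g
  | zero => 0
  | add s t => s.eval f + t.eval f
  | smul c s => c • s.eval f
  | mul s t => s.eval f * t.eval f
  | star s => Star.star (s.eval f)

/-- The C⋆-subalgebra generated by a family of elements. -/
abbrev cstarGen {G : Type w} (f : G → B) : NonUnitalStarSubalgebra ℂ B :=
  (NonUnitalStarAlgebra.adjoin ℂ (Set.range f)).topologicalClosure

instance {G : Type w} (f : G → B) : IsClosed (cstarGen f : Set B) :=
  NonUnitalStarSubalgebra.isClosed_topologicalClosure _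

lemma mem_cstarGen {G : Type w} (f : G → B) (g : G) : f g ∈ cstarGen f :=
  NonUnitalStarSubalgebra.le_topologicalClosure _
    (NonUnitalStarAlgebra.subset_adjoin ℂ _ (Set.mem_range_self g))

/-- `*`-homomorphisms that agree on generators are equal. -/
lemma cstarGen_hom_ext {G : Type w} {C : Type*} [NonUnitalCStarAlgebra C] (f : G → B)
    {φ ψ : cstarGen f →⋆ₙₐ[ℂ] C}
    (h : ∀ g, φ ⟨f g, mem_cstarGen f g⟩ = ψ ⟨f g, mem_cstarGen f g⟩) : φ = ψ := by
  have key : ∀ a ∈ NonUnitalStarAlgebra.adjoin ℂ (Set.range f), ∀ ha : a ∈ cstarGen f,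
      φ ⟨a, ha⟩ = ψ ⟨a, ha⟩ := by
    intro a ha
    have hle : ∀ {b}, b ∈ NonUnitalStarAlgebra.adjoin ℂ (Set.range f) → b ∈ cstarGen f :=
      fun hb => NonUnitalStarSubalgebra.le_topologicalClosure _ hb
    induction ha using NonUnitalStarAlgebra.adjoin_induction with
    | mem x hx => obtain ⟨g, rfl⟩ := hx; intro _; exact h g
    | zero => intro h0; exact (map_zero φ).trans (map_zero ψ).symm
    | add x y hx hy ihx ihy =>
      intro _
      have e : (⟨x + y, ‹_›⟩ : cstarGen f) = ⟨x, hle hx⟩ + ⟨y, hle hy⟩ := rfl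
      rw [e, map_add, map_add, ihx, ihy]
    | mul x y hx hy ihx ihy =>
      intro _
      have e : (⟨x * y, ‹_›⟩ : cstarGen f) = ⟨x, hle hx⟩ * ⟨y, hle hy⟩ := rfl
      rw [e, map_mul, map_mul, ihx, ihy]
    | smul c x hx ihx =>
      intro _
      have e : (⟨c • x, ‹_›⟩ : cstarGen f) = c • ⟨x, hle hx⟩ := rfl
      rw [e, map_smul, map_smul, ihx]
    | star x hx ihx =>
      intro _
      have e : (⟨star x, ‹_›⟩ : cstarGen f) = star ⟨x, hle hx⟩ := rfl
      rw [e, map_star, map_star, ihx]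
  have hcl : IsClosed {a : cstarGen f | φ a = ψ a} :=
    isClosed_eq (map_continuous φ) (map_continuous ψ)
  ext a
  have hmem : a ∈ closure {a : cstarGen f | φ a = ψ a} := by
    rw [closure_subtype]
    refine closure_mono ?_ a.2
    intro b hb
    exact ⟨⟨b, NonUnitalStarSubalgebra.le_topologicalClosure _ hb⟩, key b hb _, rfl⟩
  rw [hcl.closure_eq] at hmem
  exact hmem

instance small_cstarGen (f : G → B) : Small.{u} (cstarGen f) := by
  have h1 : ∀ a ∈ NonUnitalStarAlgebra.adjoin ℂ (Set.range f), ∃ t : StarExpr G, t.eval f = a := by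
    intro a ha
    induction ha using NonUnitalStarAlgebra.adjoin_induction with
    | mem x hx => obtain ⟨g, rfl⟩ := hx; exact ⟨.gen g, rfl⟩
    | zero => exact ⟨.zero, rfl⟩
    | add x y hx hy ihx ihy =>
      obtain ⟨s, rfl⟩ := ihx; obtain ⟨t, rfl⟩ := ihy; exact ⟨.add s t, rfl⟩
    | mul x y hx hy ihx ihy =>
      obtain ⟨s, rfl⟩ := ihx; obtain ⟨t, rfl⟩ := ihy; exact ⟨.mul s t, rfl⟩
    | smul c x hx ihx => obtain ⟨s, rfl⟩ := ihx; exact ⟨.smul c s, rfl⟩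
    | star x hx ihx => obtain ⟨s, rfl⟩ := ihx; exact ⟨.star s, rfl⟩
  have h2 : (cstarGen f : Set B) ⊆
      Set.range (fun s : ℕ → StarExpr G => @Classical.epsilon B ⟨0⟩ fun b =>
        Filter.Tendsto (fun n => (s n).eval f) Filter.atTop (nhds b)) := by
    intro b hb
    obtain ⟨x, hx, hlim⟩ := mem_closure_iff_seq_limit.1
      (show b ∈ closure (NonUnitalStarAlgebra.adjoin ℂ (Set.range f) : Set B) from hb)
    choose s hs using fun n => h1 (x n) (hx n)
    refine ⟨s, ?_⟩
    have hlim' : Filter.Tendsto (fun n => (s n).eval f) Filter.atTop (nhds b) := by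
      simpa only [hs] using hlim
    exact tendsto_nhds_unique (Classical.epsilon_spec (p := fun b =>
      Filter.Tendsto (fun n => (s n).eval f) Filter.atTop (nhds b)) ⟨b, hlim'⟩) hlim'
  exact small_subset h2

/-- Every C⋆-algebra generated by a family indexed by `G` has a copy in the universe of `G`. -/
lemma exists_small_copy (f : G → B) :
    ∃ (C : Type u) (_ : NonUnitalCStarAlgebra C) (j : C →⋆ₙₐ[ℂ] B),
      Function.Injective j ∧ ∀ g, ∃ c, j c = f g := by
  let S := cstarGen f
  let e : Shrink.{u} S ≃ S := (equivShrink S).symm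
  let hs : Star (Shrink.{u} S) := ⟨fun a => e.symm (star (e a))⟩
  have es : ∀ a, e (star a) = star (e a) := fun a => e.apply_symm_apply _
  have ea : ∀ a b, e (a + b) = e a + e b := fun a b => e.apply_symm_apply _
  have em : ∀ a b, e (a * b) = e a * e b := fun a b => e.apply_symm_apply _
  have ec : ∀ (c : ℂ) a, e (c • a) = c • e a := fun a b => e.apply_symm_apply _
  have e0 : e 0 = 0 := e.apply_symm_apply _
  let φ : Shrink.{u} S →ₙ+* S :=
    { toFun := e, map_mul' := em, map_zero' := e0, map_add' := ea }
  let n1 : NonUnitalNormedRing (Shrink.{u} S) :=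
    NonUnitalNormedRing.induced (Shrink.{u} S) S φ e.injective
  have hn : ∀ a : Shrink.{u} S, ‖a‖ = ‖e a‖ := fun a => rfl
  let n2 : StarRing (Shrink.{u} S) :=
    { star_involutive := fun a => e.injective (by rw [es, es, star_star])
      star_mul := fun a b => e.injective (by rw [es, em, em, es, es, star_mul])
      star_add := fun a b => e.injective (by rw [es, ea, ea, es, es, star_add]) }
  let n3 : NormedSpace ℂ (Shrink.{u} S) :=
    { norm_smul_le := fun c a => by
        change ‖e (c • a)‖ ≤ ‖c‖ * ‖e a‖
        rw [ec]; exact norm_smul_le _ _ }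
  have iso : Isometry e := AddMonoidHomClass.isometry_of_norm φ (fun a => (hn a).symm)
  have ui : IsUniformInducing e := iso.isUniformInducing
  let n : NonUnitalCStarAlgebra (Shrink.{u} S) :=
    { n1, n2, n3 with
      complete := ((completeSpace_congr (e := e) iso.isUniformEmbedding).2 inferInstance).complete
      norm_mul_self_le := fun a => by
        rw [hn, hn, em, es]; exact CStarRing.norm_mul_self_le (x := e a)
      smul_assoc := fun c a b => e.injective (by
        simp only [smul_eq_mul, em, ec, smul_mul_assoc])
      smul_comm := fun c a b => e.injective (by
        simp only [smul_eq_mul, em, ec, mul_smul_comm])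
      star_smul := fun c a => e.injective (by rw [es, ec, ec, es, star_smul]) }
  refine ⟨Shrink.{u} S, n, (NonUnitalStarSubalgebraClass.subtype S).comp
    { φ with
      map_smul' := ec
      map_star' := es }, ?_, fun g => ⟨e.symm ⟨f g, mem_cstarGen f g⟩, ?_⟩⟩
  · exact Subtype.val_injective.comp e.injective
  · exact congrArg Subtype.val (e.apply_symm_apply _)

end Small

section Positivity

/-- A square matrix `P` over a unital C⋆-algebra satisfies `0 ≤ P ≤ 1`, that is, both `P` and
`1 - P` are of the form `Yᴴ * Y`. -/
structure MatrixZeroLeOne {A : Type*} [CStarAlgebra A] (P : Matrix (Fin 2) (Fin 2) A) : Prop where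
  nonneg : ∃ Y : Matrix (Fin 2) (Fin 2) A, P = Y.conjTranspose * Y
  le_one : ∃ Z : Matrix (Fin 2) (Fin 2) A, 1 - P = Z.conjTranspose * Z

lemma nonneg_iff_star_mul_self {A : Type u} [CStarAlgebra A] [PartialOrder A]
    [StarOrderedRing A] {a : A} : 0 ≤ a ↔ ∃ b, a = star b * b :=
  CStarAlgebra.nonneg_iff_eq_star_mul_self

lemma nonneg_of_jointly_injective {A : Type u} [CStarAlgebra A] [PartialOrder A]
    [StarOrderedRing A] {I : Type w} {C : I → Type v} [∀ i, CStarAlgebra (C i)]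
    [∀ i, PartialOrder (C i)] [∀ i, StarOrderedRing (C i)]
    (φ : ∀ i, A →⋆ₐ[ℂ] C i) (hφ : ∀ a, (∀ i, φ i a = 0) → a = 0) {a : A}
    (ha : ∀ i, 0 ≤ φ i a) : 0 ≤ a := by
  have hsa : IsSelfAdjoint a := by
    refine sub_eq_zero.1 (hφ _ fun i => ?_)
    rw [map_sub, map_star, (IsSelfAdjoint.of_nonneg (ha i)).star_eq, sub_self]
  rw [CStarAlgebra.nonneg_iff_isSelfAdjoint_and_negPart_eq_zero]
  refine ⟨hsa, hφ _ fun i => ?_⟩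
  have hsi : IsSelfAdjoint (φ i a) := .of_nonneg (ha i)
  have hc : Continuous (φ i) := map_continuous (φ i)
  have h1 : φ i (a⁻) = (φ i a)⁻ := by
    rw [CFC.negPart_def, CFC.negPart_def]
    exact NonUnitalStarAlgHomClass.map_cfcₙ (S := ℂ) (φ i) _ a
  rw [h1]
  exact (CStarAlgebra.nonneg_iff_isSelfAdjoint_and_negPart_eq_zero.1 (ha i)).2

lemma MatrixZeroLeOne.map {A : Type u} {C : Type v} [CStarAlgebra A] [CStarAlgebra C]
    (φ : A →⋆ₐ[ℂ] C) {P : Matrix (Fin 2) (Fin 2) A} (h : MatrixZeroLeOne P) :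
    MatrixZeroLeOne (P.map φ) := by
  have key : ∀ Y : Matrix (Fin 2) (Fin 2) A,
      (Y.conjTranspose * Y).map φ = (Y.map φ).conjTranspose * Y.map φ := by
    intro Y
    ext i j
    simp [Matrix.mul_apply, map_star]
  obtain ⟨⟨Y, hY⟩, ⟨Z, hZ⟩⟩ := h
  refine ⟨⟨Y.map φ, by rw [hY, key]⟩, ⟨Z.map φ, ?_⟩⟩
  rw [← key, ← hZ]
  ext i j
  fin_cases i <;> fin_cases j <;> simp

lemma matrixZeroLeOne_of_jointly_injective {A : Type u} [CStarAlgebra A] {I : Type w}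
    {C : I → Type v} [∀ i, CStarAlgebra (C i)]
    (φ : ∀ i, A →⋆ₐ[ℂ] C i) (hφ : ∀ a, (∀ i, φ i a = 0) → a = 0)
    {P : Matrix (Fin 2) (Fin 2) A} (h : ∀ i, MatrixZeroLeOne (P.map (φ i))) :
    MatrixZeroLeOne P := by
  let _ := CStarAlgebra.spectralOrder A
  let _ := CStarAlgebra.spectralOrderedRing A
  let _ := fun i => CStarAlgebra.spectralOrder (C i)
  let _ := fun i => CStarAlgebra.spectralOrderedRing (C i)
  let Φ : ∀ i, CStarMatrix (Fin 2) (Fin 2) A →⋆ₐ[ℂ] CStarMatrix (Fin 2) (Fin 2) (C i) := fun i =>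
    { toFun := fun M => M.map (φ i)
      map_one' := by ext k l; fin_cases k <;> fin_cases l <;> simp
      map_mul' := fun M N => by ext k l; simp [CStarMatrix.mul_apply]
      map_zero' := by ext k l; simp
      map_add' := fun M N => by ext k l; simp
      commutes' := fun r => by
        ext k l
        fin_cases k <;> fin_cases l <;>
          simp [CStarMatrix.algebraMap_apply, AlgHomClass.commutes]
      map_star' := fun M => by ext k l; simp [CStarMatrix.star_apply, map_star] }
  have hΦ : ∀ M, (∀ i, Φ i M = 0) → M = 0 := by
    intro M hM
    ext k l
    refine hφ _ fun i => ?_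
    exact congrFun (congrFun (hM i) k) l
  have key : ∀ M : Matrix (Fin 2) (Fin 2) A,
      (∀ i, ∃ Y : Matrix (Fin 2) (Fin 2) (C i), M.map (φ i) = Y.conjTranspose * Y) →
      ∃ Y : Matrix (Fin 2) (Fin 2) A, M = Y.conjTranspose * Y := by
    intro M hM
    have : 0 ≤ (CStarMatrix.ofMatrix M) := by
      refine nonneg_of_jointly_injective Φ hΦ fun i => ?_
      obtain ⟨Y, hY⟩ := hM i
      exact nonneg_iff_star_mul_self.2 ⟨CStarMatrix.ofMatrix Y, hY⟩
    obtain ⟨Y, hY⟩ := nonneg_iff_star_mul_self.1 this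
    exact ⟨Y, hY⟩
  refine ⟨key _ fun i => (h i).1, key _ fun i => ?_⟩
  obtain ⟨Z, hZ⟩ := (h i).2
  refine ⟨Z, ?_⟩
  rw [← hZ]
  ext k l
  fin_cases k <;> fin_cases l <;> simp

end Positivity

section UniversalAlgebras

/-- The matrix with rows `(𝟙 - h, x⋆)` and `(x, k)` over the unitization; the unit `𝟙` is always
an added one. -/
def relationMatrix {B : Type v} [NonUnitalCStarAlgebra B] (h k x : B) :
    Matrix (Fin 2) (Fin 2) (Unitization ℂ B) :=
  !![1 - (h : Unitization ℂ B), ((star x : B) : Unitization ℂ B);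
     (x : Unitization ℂ B), (k : Unitization ℂ B)]

/-- The relations `h k = 0` and `0 ≤ P ≤ 1` for `P` the matrix with rows `(𝟙 - h, x⋆)`, `(x, k)`. -/
structure IsPTriple {B : Type v} [NonUnitalCStarAlgebra B] (h k x : B) : Prop where
  mul_eq_zero : h * k = 0
  zero_le_one : MatrixZeroLeOne (relationMatrix h k x)

lemma norm_le_one_of_star_mul {A : Type u} [CStarAlgebra A] [PartialOrder A] [StarOrderedRing A]
    {P : A} (h1 : ∃ Y, P = star Y * Y) (h2 : ∃ Z, 1 - P = star Z * Z) : ‖P‖ ≤ 1 := by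
  have h1' : 0 ≤ P := nonneg_iff_star_mul_self.2 h1
  have h2' : 0 ≤ 1 - P := nonneg_iff_star_mul_self.2 h2
  exact (CStarAlgebra.norm_le_one_iff_of_nonneg P h1').2 (sub_nonneg.1 h2')

lemma MatrixZeroLeOne.norm_entry_le {A : Type u} [CStarAlgebra A]
    {P : Matrix (Fin 2) (Fin 2) A} (h : MatrixZeroLeOne P) (i j : Fin 2) : ‖P i j‖ ≤ 1 := by
  let _ := CStarAlgebra.spectralOrder A
  let _ := CStarAlgebra.spectralOrderedRing A
  have h1 : ‖CStarMatrix.ofMatrix P‖ ≤ 1 := norm_le_one_of_star_mul h.1 h.2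
  exact (CStarMatrix.norm_entry_le_norm (M := CStarMatrix.ofMatrix P)).trans h1

lemma IsPTriple.norm_le {B : Type v} [NonUnitalCStarAlgebra B] {h k x : B}
    (H : IsPTriple h k x) : ‖h‖ ≤ 2 ∧ ‖k‖ ≤ 2 ∧ ‖x‖ ≤ 2 := by
  have e00 : ‖1 - (h : Unitization ℂ B)‖ ≤ 1 := H.2.norm_entry_le 0 0
  have e10 : ‖(x : Unitization ℂ B)‖ ≤ 1 := H.2.norm_entry_le 1 0
  have e11 : ‖(k : Unitization ℂ B)‖ ≤ 1 := H.2.norm_entry_le 1 1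
  rw [Unitization.norm_inr] at e10 e11
  refine ⟨?_, by linarith, by linarith⟩
  rw [← Unitization.norm_inr (𝕜 := ℂ)]
  calc ‖(h : Unitization ℂ B)‖ = ‖1 - (1 - (h : Unitization ℂ B))‖ := by rw [sub_sub_cancel]
    _ ≤ ‖(1 : Unitization ℂ B)‖ + ‖1 - (h : Unitization ℂ B)‖ := norm_sub_le _ _
    _ ≤ 2 := by rw [norm_one]; linarith

lemma relationMatrix_map {A : Type u} {B : Type v} [NonUnitalCStarAlgebra A]
    [NonUnitalCStarAlgebra B] (φ : A →⋆ₙₐ[ℂ] B) (h k x : A) :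
    (relationMatrix h k x).map (Unitization.starMap φ) = relationMatrix (φ h) (φ k) (φ x) := by
  have h00 : Unitization.starMap φ (1 - (h : Unitization ℂ A)) = 1 - (φ h : Unitization ℂ B) := by
    rw [map_sub, map_one, Unitization.starMap_inr]
  refine Matrix.ext fun i j => ?_
  fin_cases i <;> fin_cases j
  · exact h00
  · simp [relationMatrix, map_star]
  · simp [relationMatrix]
  · simp [relationMatrix]

lemma IsPTriple.map {A : Type u} {B : Type v} [NonUnitalCStarAlgebra A] [NonUnitalCStarAlgebra B]
    (φ : A →⋆ₙₐ[ℂ] B) {h k x : A} (H : IsPTriple h k x) : IsPTriple (φ h) (φ k) (φ x) :=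
  ⟨by rw [← map_mul, H.1, map_zero], by
    rw [← relationMatrix_map]; exact H.2.map (Unitization.starMap φ)⟩

lemma isPTriple_of_jointly_injective {A : Type u} [NonUnitalCStarAlgebra A] {I : Type w}
    [Nonempty I] {C : I → Type v} [∀ i, NonUnitalCStarAlgebra (C i)] (φ : ∀ i, A →⋆ₙₐ[ℂ] C i)
    (hφ : ∀ a, (∀ i, φ i a = 0) → a = 0) {h k x : A}
    (H : ∀ i, IsPTriple (φ i h) (φ i k) (φ i x)) : IsPTriple h k x := by
  refine ⟨hφ _ fun i => by rw [map_mul, (H i).1],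
    matrixZeroLeOne_of_jointly_injective (fun i => Unitization.starMap (φ i)) ?_ fun i => ?_⟩
  · intro a ha
    induction a using Unitization.ind with
    | inl_add_inr r a =>
      have ha' : ∀ i, Unitization.inl r + (Unitization.inr (φ i a) : Unitization ℂ (C i)) = 0 := by
        intro i
        have := ha i
        rw [map_add, Unitization.starMap_inr, Unitization.starMap_inl] at this
        exact this
      have hr : r = 0 := by
        obtain ⟨i⟩ := ‹Nonempty I›
        simpa using congrArg (fun z => z.toProd.1) (ha' i)
      have h0 : a = 0 := hφ _ fun i => by simpa using congrArg (fun z => z.toProd.2) (ha' i)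
      rw [hr, h0, Unitization.inl_zero, Unitization.inr_zero, add_zero]
  · rw [relationMatrix_map]; exact (H i).2

/-- All triples satisfying the relations, in all C⋆-algebras of the lowest universe. -/
structure PRep : Type 1 where
  carrier : Type
  [inst : NonUnitalCStarAlgebra carrier]
  h : carrier
  k : carrier
  x : carrier
  isPTriple : IsPTriple h k x

attribute [instance] PRep.inst

lemma isPTriple_zero (B : Type v) [NonUnitalCStarAlgebra B] : IsPTriple (0 : B) 0 0 := by
  refine ⟨by simp, ⟨⟨!![1, 0; 0, 0], ?_⟩, ⟨!![0, 0; 0, 1], ?_⟩⟩⟩ <;>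
  · refine Matrix.ext fun i j => ?_
    fin_cases i <;> fin_cases j <;> simp [relationMatrix, Matrix.mul_apply]

instance : Nonempty PRep := ⟨⟨ℂ, 0, 0, 0, isPTriple_zero ℂ⟩⟩

/-- The product over all triples satisfying the relations, of the elements `h`, `k`, `x`. -/
noncomputable def PRep.generator : Fin 3 → lp (fun r : PRep => r.carrier) ∞ :=
  ![⟨fun r => r.h, memℓp_infty ⟨2, by rintro _ ⟨r, rfl⟩; exact r.isPTriple.norm_le.1⟩⟩,
    ⟨fun r => r.k, memℓp_infty ⟨2, by rintro _ ⟨r, rfl⟩; exact r.isPTriple.norm_le.2.1⟩⟩,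
    ⟨fun r => r.x, memℓp_infty ⟨2, by rintro _ ⟨r, rfl⟩; exact r.isPTriple.norm_le.2.2⟩⟩]

/-- The universal C⋆-algebra `𝒫` on generators `h, k, x` subject to `h k = 0` and `0 ≤ P ≤ 1`,
realised as the C⋆-algebra generated by the universal representation (the product of all
representations). Its universal property is `AlgP.isPTriple` and `AlgP.existsUnique_hom`. -/
def AlgP : Type 1 := cstarGen PRep.generator

namespace AlgP

noncomputable instance : NonUnitalCStarAlgebra AlgP :=
  inferInstanceAs (NonUnitalCStarAlgebra (cstarGen PRep.generator))

/-- The generators of `𝒫`. -/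
noncomputable def h : AlgP := ⟨_, mem_cstarGen PRep.generator 0⟩
noncomputable def k : AlgP := ⟨_, mem_cstarGen PRep.generator 1⟩
noncomputable def x : AlgP := ⟨_, mem_cstarGen PRep.generator 2⟩

/-- The coordinate homomorphism at a representation. -/
noncomputable def eval (r : PRep) : AlgP →⋆ₙₐ[ℂ] r.carrier where
  toFun a := a.1 r
  map_smul' _ _ := rfl
  map_zero' := rfl
  map_add' _ _ := rfl
  map_mul' _ _ := rfl
  map_star' _ := rfl

lemma eval_jointly_injective (a : AlgP) (ha : ∀ r, eval r a = 0) : a = 0 :=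
  Subtype.ext (lp.ext (funext ha))

/-- The generators of `𝒫` satisfy the relations. -/
lemma isPTriple : IsPTriple h k x :=
  isPTriple_of_jointly_injective eval eval_jointly_injective fun r => r.isPTriple

/-- Universal property of `𝒫`: triples in `B` satisfying the relations correspond to
`*`-homomorphisms from `𝒫` to `B`, for C⋆-algebras `B` in every universe. -/
theorem existsUnique_hom {B : Type v} [NonUnitalCStarAlgebra B] {h' k' x' : B}
    (H : IsPTriple h' k' x') : ∃! φ : AlgP →⋆ₙₐ[ℂ] B, φ h = h' ∧ φ k = k' ∧ φ x = x' := by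
  obtain ⟨C, _, j, hj, hg⟩ := exists_small_copy (G := Fin 3) ![h', k', x']
  obtain ⟨h₁, rfl⟩ : ∃ c, j c = h' := hg 0
  obtain ⟨k₁, rfl⟩ : ∃ c, j c = k' := hg 1
  obtain ⟨x₁, rfl⟩ : ∃ c, j c = x' := hg 2
  have H₁ : IsPTriple h₁ k₁ x₁ :=
    isPTriple_of_jointly_injective (fun _ : Unit => j)
      (fun a ha => hj ((ha ()).trans (map_zero j).symm)) fun _ => H
  refine ⟨j.comp (eval ⟨C, h₁, k₁, x₁, H₁⟩), ⟨rfl, rfl, rfl⟩, ?_⟩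
  rintro φ ⟨e1, e2, e3⟩
  refine cstarGen_hom_ext PRep.generator (φ := φ) fun g => ?_
  fin_cases g
  · exact e1
  · exact e2
  · exact e3

end AlgP

/-- All pairs of `*`-homomorphisms from `A` and `B` to a common C⋆-algebra. -/
structure FreeProductRep (A B : Type u) [NonUnitalCStarAlgebra A] [NonUnitalCStarAlgebra B] :
    Type (u + 1) where
  carrier : Type u
  [inst : NonUnitalCStarAlgebra carrier]
  left : A →⋆ₙₐ[ℂ] carrier
  right : B →⋆ₙₐ[ℂ] carrier

attribute [instance] FreeProductRep.inst

variable (A B : Type u) [NonUnitalCStarAlgebra A] [NonUnitalCStarAlgebra B]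

/-- The product over all pairs of `*`-homomorphisms, of the images of the elements of `A`
and of `B`. -/
noncomputable def FreeProductRep.generator :
    A ⊕ B → lp (fun r : FreeProductRep A B => r.carrier) ∞
  | .inl a => ⟨fun r => r.left a, memℓp_infty ⟨‖a‖, by
      rintro _ ⟨r, rfl⟩; exact NonUnitalStarAlgHom.norm_apply_le r.left a⟩⟩
  | .inr b => ⟨fun r => r.right b, memℓp_infty ⟨‖b‖, by
      rintro _ ⟨r, rfl⟩; exact NonUnitalStarAlgHom.norm_apply_le r.right b⟩⟩

/-- The (non-unital) free product `A ∗ B` of C⋆-algebras, that is, the C⋆-algebra generated by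
universal copies of `A` and `B`. Its universal property is `CStarFreeProduct.existsUnique_hom`. -/
def CStarFreeProduct : Type (u + 1) := cstarGen (FreeProductRep.generator A B)

namespace CStarFreeProduct

noncomputable instance : NonUnitalCStarAlgebra (CStarFreeProduct A B) :=
  inferInstanceAs (NonUnitalCStarAlgebra (cstarGen (FreeProductRep.generator A B)))

variable {A B}

/-- The canonical homomorphism `A → A ∗ B`. -/
noncomputable def inl : A →⋆ₙₐ[ℂ] CStarFreeProduct A B where
  toFun a := ⟨_, mem_cstarGen (FreeProductRep.generator A B) (.inl a)⟩
  map_smul' c a := Subtype.ext (lp.ext (funext fun r => map_smul r.left c a))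
  map_zero' := Subtype.ext (lp.ext (funext fun r => map_zero r.left))
  map_add' a b := Subtype.ext (lp.ext (funext fun r => map_add r.left a b))
  map_mul' a b := Subtype.ext (lp.ext (funext fun r => map_mul r.left a b))
  map_star' a := Subtype.ext (lp.ext (funext fun r => map_star r.left a))

/-- The canonical homomorphism `B → A ∗ B`. -/
noncomputable def inr : B →⋆ₙₐ[ℂ] CStarFreeProduct A B where
  toFun b := ⟨_, mem_cstarGen (FreeProductRep.generator A B) (.inr b)⟩
  map_smul' c a := Subtype.ext (lp.ext (funext fun r => map_smul r.right c a))
  map_zero' := Subtype.ext (lp.ext (funext fun r => map_zero r.right))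
  map_add' a b := Subtype.ext (lp.ext (funext fun r => map_add r.right a b))
  map_mul' a b := Subtype.ext (lp.ext (funext fun r => map_mul r.right a b))
  map_star' a := Subtype.ext (lp.ext (funext fun r => map_star r.right a))

/-- The coordinate homomorphism at a pair of homomorphisms. -/
noncomputable def eval (r : FreeProductRep A B) : CStarFreeProduct A B →⋆ₙₐ[ℂ] r.carrier where
  toFun a := a.1 r
  map_smul' _ _ := rfl
  map_zero' := rfl
  map_add' _ _ := rfl
  map_mul' _ _ := rfl
  map_star' _ := rfl

/-- Universal property of the free product: it is the coproduct of `A` and `B` among all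
C⋆-algebras, in every universe. -/
theorem existsUnique_hom {C : Type v} [NonUnitalCStarAlgebra C] (φ : A →⋆ₙₐ[ℂ] C)
    (ψ : B →⋆ₙₐ[ℂ] C) :
    ∃! χ : CStarFreeProduct A B →⋆ₙₐ[ℂ] C, χ.comp inl = φ ∧ χ.comp inr = ψ := by
  obtain ⟨D, _, j, hj, hg⟩ := exists_small_copy (Sum.elim (φ : A → C) (ψ : B → C))
  have factor : ∀ {E : Type u} [NonUnitalCStarAlgebra E] (f : E →⋆ₙₐ[ℂ] C),
      (∀ a, ∃ d, j d = f a) → ∃ f' : E →⋆ₙₐ[ℂ] D, j.comp f' = f := by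
    intro E _ f hf
    choose t ht using hf
    refine ⟨
      { toFun := t
        map_smul' := fun c a => hj ?_
        map_zero' := hj ?_
        map_add' := fun a b => hj ?_
        map_mul' := fun a b => hj ?_
        map_star' := fun a => hj ?_ }, ?_⟩
    · change j (t (c • a)) = j (c • t a)
      rw [map_smul, ht, ht, map_smul]
    · change j (t 0) = j 0
      rw [ht, map_zero, map_zero]
    · change j (t (a + b)) = j (t a + t b)
      rw [map_add, ht, ht, ht, map_add]
    · rw [map_mul, ht, ht, ht, map_mul]
    · rw [map_star, ht, ht, map_star]
    · ext a
      exact ht a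
  obtain ⟨φ', rfl⟩ := factor φ fun a => hg (.inl a)
  obtain ⟨ψ', rfl⟩ := factor ψ fun b => hg (.inr b)
  refine ⟨j.comp (eval ⟨D, φ', ψ'⟩), ⟨rfl, rfl⟩, ?_⟩
  rintro χ ⟨e1, e2⟩
  refine cstarGen_hom_ext (FreeProductRep.generator A B) (φ := χ) fun g => ?_
  rcases g with a | b
  · exact DFunLike.congr_fun e1 a
  · exact DFunLike.congr_fun e2 b

end CStarFreeProduct

/-- The inclusion function `t ↦ t` in `C₀(0,1]`, its canonical positive contractive generator. -/
def idC₀ : C₀(Set.Ioc (0 : ℝ) 1, ℂ) where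
  toFun t := ((t : ℝ) : ℂ)
  continuous_toFun := by fun_prop
  zero_at_infty' := by
    rw [Metric.tendsto_nhds]
    intro ε hε
    have hK : IsCompact ((fun t : Set.Ioc (0 : ℝ) 1 => (t : ℝ)) ⁻¹' Set.Icc ε 1) := by
      rw [Topology.IsInducing.subtypeVal.isCompact_iff]
      have : Subtype.val '' ((fun t : Set.Ioc (0 : ℝ) 1 => (t : ℝ)) ⁻¹' Set.Icc ε 1) =
          Set.Icc ε 1 := by
        rw [Subtype.image_preimage_coe]
        exact Set.inter_eq_right.2 fun t ht => ⟨hε.trans_le ht.1, ht.2⟩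
      rw [this]
      exact isCompact_Icc
    filter_upwards [hK.compl_mem_cocompact] with t ht
    have h1 : ¬ ε ≤ (t : ℝ) := fun h => ht ⟨h, t.2.2⟩
    rw [dist_zero_right, Complex.norm_real, Real.norm_of_nonneg t.2.1.le]
    exact not_le.1 h1

/-- The free product `ℂ ∗ C₀(0,1]`. -/
abbrev FreeProductCC₀ : Type 1 := CStarFreeProduct ℂ C₀(Set.Ioc (0 : ℝ) 1, ℂ)

/-- The generating projection of `ℂ ∗ C₀(0,1]`, the image of `1 ∈ ℂ`. -/
noncomputable def FreeProductCC₀.p : FreeProductCC₀ := CStarFreeProduct.inl 1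

/-- The generating positive contraction of `ℂ ∗ C₀(0,1]`, the image of `t ↦ t` in `C₀(0,1]`. -/
noncomputable def FreeProductCC₀.l : FreeProductCC₀ := CStarFreeProduct.inr idC₀

end UniversalAlgebras

/-! Existence of `θ`: for a projection `q` and a positive contraction `a`, the corners of `a`
relative to `q` satisfy the relations of `𝒫`, with `h = q - qaq` (`isPTriple_of_projection`); apply
this to `p` and `l`.

Injectivity: the construction is reversed inside the multiplier algebra of `𝒫`. There `h` has a
support projection `q`, the strict limit of functions of `h`, with `qh = h`, `qx⋆ = x⋆` and `qk = qx
= 0` (`AlgP.exists_support_projection`). These identities come from `hk = 0` and from the principle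
that a diagonal entry of a positive matrix controls its column. Then `a = q - h + x + x⋆ + k` is the
compression of `P` by the column `(q, 1 - q)`, hence a positive contraction. The homomorphism `Ψ`
with `p ↦ q`, `l ↦ a` satisfies `Ψ ∘ θ =` the canonical embedding of `𝒫`
(`AlgP.exists_hom_multiplier`), so `θ` is injective, therefore isometric with closed range.

Exactness: `p` multiplies the range of `θ` into itself, and `l - p = θ(-h + x + x⋆ + k)` lies in
that range (`l_eq`). So the range is an ideal modulo which `l` and `p` agree. The quotient is
spanned by the class of `p`, and `b - ρ(b)p` lies in the range for all `b` (`sub_smul_mem_range`).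
As `ρ` vanishes on the range, the range is its kernel. -/

/-! ### Functional calculus of a positive contraction as a homomorphism from `C₀(0,1]` -/

/-- The extension by zero of a function in `C₀(0,1]`, composed with the real part. -/
noncomputable def extendZero (f : C₀(Set.Ioc (0 : ℝ) 1, ℂ)) (z : ℂ) : ℂ :=
  if h : z.re ∈ Set.Ioc (0 : ℝ) 1 then f ⟨z.re, h⟩ else 0

lemma extendZero_zero (f : C₀(Set.Ioc (0 : ℝ) 1, ℂ)) : extendZero f 0 = 0 := by
  simp [extendZero]

lemma extendZero_coe (f : C₀(Set.Ioc (0 : ℝ) 1, ℂ)) (t : Set.Ioc (0 : ℝ) 1) :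
    extendZero f ((t : ℝ) : ℂ) = f t := by
  have h : ((t : ℝ) : ℂ).re ∈ Set.Ioc (0 : ℝ) 1 := t.2
  rw [extendZero, dif_pos h]
  rfl

/-- Only continuity at `0` needs vanishing at infinity: outside a compact subset of `(0,1]` the
function is small, and such a set is closed in `ℝ` and misses `0`. -/
lemma continuousOn_extendZero_ofReal (f : C₀(Set.Ioc (0 : ℝ) 1, ℂ)) :
    ContinuousOn (fun t : ℝ => extendZero f t) (Set.Icc 0 1) := by
  intro t ht
  rcases ht.1.eq_or_lt with rfl | h0
  · rw [ContinuousWithinAt, Complex.ofReal_zero, extendZero_zero, Metric.tendsto_nhds]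
    intro ε hε
    have h1 := Metric.tendsto_nhds.1 f.zero_at_infty' ε hε
    obtain ⟨K, hK, hKε⟩ := Filter.mem_cocompact.1 h1
    have hc : IsClosed (Subtype.val '' K : Set ℝ) := (hK.image continuous_subtype_val).isClosed
    have hn : (0 : ℝ) ∈ (Subtype.val '' K : Set ℝ)ᶜ := by
      rintro ⟨s, -, hs⟩
      exact s.2.1.ne' hs
    filter_upwards [mem_nhdsWithin_of_mem_nhds (hc.isOpen_compl.mem_nhds hn)] with s hs
    by_cases h : s ∈ Set.Ioc (0 : ℝ) 1
    · rw [extendZero_coe f ⟨s, h⟩]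
      exact hKε fun hsK => hs ⟨_, hsK, rfl⟩
    · have h' : ((s : ℝ) : ℂ).re ∉ Set.Ioc (0 : ℝ) 1 := h
      rw [extendZero, dif_neg h', dist_self]
      exact hε
  · have hc : ContinuousOn (fun t : ℝ => extendZero f t) (Set.Ioc 0 1) := by
      rw [continuousOn_iff_continuous_domRestrict]
      convert! f.continuous using 1
      ext s
      exact extendZero_coe f s
    refine (hc t ⟨h0, ht.2⟩).mono_of_mem_nhdsWithin ?_
    filter_upwards [self_mem_nhdsWithin, mem_nhdsWithin_of_mem_nhds (lt_mem_nhds h0)] with s hs hs'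
    exact ⟨hs', hs.2⟩

lemma continuousOn_extendZero (f : C₀(Set.Ioc (0 : ℝ) 1, ℂ)) :
    ContinuousOn (extendZero f) (Complex.ofReal '' Set.Icc 0 1) := by
  have h : ContinuousOn (fun z : ℂ => extendZero f (z.re : ℂ)) (Complex.ofReal '' Set.Icc 0 1) := by
    refine (continuousOn_extendZero_ofReal f).comp Complex.continuous_re.continuousOn ?_
    rintro _ ⟨t, ht, rfl⟩
    exact ht
  exact h.congr fun _ _ => rfl

/-- `a` is a positive contraction: `a = b⋆ b` for some `b`, and `‖a‖ ≤ 1`. -/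
structure IsPosContraction {A : Type*} [NonUnitalCStarAlgebra A] (a : A) : Prop where
  exists_star_mul : ∃ b, a = star b * b
  norm_le_one : ‖a‖ ≤ 1

namespace IsPosContraction

variable {A : Type*} {B : Type*} [NonUnitalCStarAlgebra A] [NonUnitalCStarAlgebra B] {a : A}

lemma isSelfAdjoint (ha : IsPosContraction a) : IsSelfAdjoint a := by
  obtain ⟨b, rfl⟩ := ha.exists_star_mul
  exact .star_mul_self b

lemma map (φ : A →⋆ₙₐ[ℂ] B) (ha : IsPosContraction a) : IsPosContraction (φ a) := by
  obtain ⟨b, hb⟩ := ha.exists_star_mul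
  exact ⟨⟨φ b, by rw [hb, map_mul, map_star]⟩,
    (NonUnitalStarAlgHom.norm_apply_le φ a).trans ha.norm_le_one⟩

lemma quasispectrum_subset (ha : IsPosContraction a) :
    quasispectrum ℂ a ⊆ Complex.ofReal '' Set.Icc 0 1 := by
  let _ := CStarAlgebra.spectralOrder A
  let _ := CStarAlgebra.spectralOrderedRing A
  rw [← ha.isSelfAdjoint.quasispectrumRestricts.algebraMap_image]
  refine Set.image_mono fun t ht => ⟨?_, ?_⟩
  · refine quasispectrum_nonneg_of_nonneg a ?_ t ht
    obtain ⟨b, rfl⟩ := ha.exists_star_mul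
    exact star_mul_self_nonneg b
  · rw [Unitization.quasispectrum_eq_spectrum_inr' ℝ ℂ a] at ht
    have := spectrum.norm_le_norm_of_mem ht
    rw [Unitization.norm_inr] at this
    exact (le_abs_self t).trans (this.trans ha.norm_le_one)

lemma continuousOn_extendZero (ha : IsPosContraction a) (f : C₀(Set.Ioc (0 : ℝ) 1, ℂ)) :
    ContinuousOn (extendZero f) (quasispectrum ℂ a) :=
  (_root_.continuousOn_extendZero f).mono ha.quasispectrum_subset

/-- The homomorphism from `C₀(0,1]` given by the functional calculus of a positive contraction. -/
noncomputable def cfcC₀ (ha : IsPosContraction a) : C₀(Set.Ioc (0 : ℝ) 1, ℂ) →⋆ₙₐ[ℂ] A where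
  toFun f := cfcₙ (extendZero f) a
  map_smul' c f := by
    rw [MonoidHom.id_apply, ← cfcₙ_smul c _ a (ha.continuousOn_extendZero f) (extendZero_zero f)]
    refine cfcₙ_congr fun z _ => ?_
    by_cases h : z.re ∈ Set.Ioc (0 : ℝ) 1 <;> simp [extendZero, h]
  map_zero' := by
    rw [← cfcₙ_zero ℂ a]
    refine cfcₙ_congr fun z _ => ?_
    by_cases h : z.re ∈ Set.Ioc (0 : ℝ) 1 <;> simp [extendZero, h]
  map_add' f g := by
    rw [← cfcₙ_add (f := extendZero f) (g := extendZero g) (a := a)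
      (hf := ha.continuousOn_extendZero f) (hf0 := extendZero_zero f)
      (hg := ha.continuousOn_extendZero g) (hg0 := extendZero_zero g)]
    refine cfcₙ_congr fun z _ => ?_
    by_cases h : z.re ∈ Set.Ioc (0 : ℝ) 1 <;> simp [extendZero, h]
  map_mul' f g := by
    rw [← cfcₙ_mul _ _ a (ha.continuousOn_extendZero f) (extendZero_zero f)
      (ha.continuousOn_extendZero g) (extendZero_zero g)]
    refine cfcₙ_congr fun z _ => ?_
    by_cases h : z.re ∈ Set.Ioc (0 : ℝ) 1 <;> simp [extendZero, h]
  map_star' f := by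
    rw [← cfcₙ_star]
    refine cfcₙ_congr fun z _ => ?_
    by_cases h : z.re ∈ Set.Ioc (0 : ℝ) 1 <;> simp [extendZero, h]

lemma cfcC₀_idC₀ (ha : IsPosContraction a) : ha.cfcC₀ idC₀ = a := by
  have hn : IsStarNormal a := ha.isSelfAdjoint.isStarNormal
  change cfcₙ (extendZero idC₀) a = a
  conv_rhs => rw [← cfcₙ_id ℂ a]
  refine cfcₙ_congr fun z hz => ?_
  obtain ⟨t, ht, rfl⟩ := ha.quasispectrum_subset hz
  rcases ht.1.eq_or_lt with rfl | h0
  · rw [Complex.ofReal_zero, extendZero_zero]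
    rfl
  · exact extendZero_coe idC₀ ⟨t, h0, ht.2⟩

end IsPosContraction

/-! ### `C₀(0,1]` is generated by `t ↦ t` -/

/-- The square root function in `C₀(0,1]`. -/
noncomputable def sqrtC₀ : C₀(Set.Ioc (0 : ℝ) 1, ℂ) where
  toFun t := ((Real.sqrt t : ℝ) : ℂ)
  continuous_toFun := by fun_prop
  zero_at_infty' := by
    have h := idC₀.zero_at_infty'
    have h2 : Continuous fun z : ℂ => ((Real.sqrt z.re : ℝ) : ℂ) := by fun_prop
    have h3 := h2.tendsto 0
    simp only [Complex.zero_re, Real.sqrt_zero, Complex.ofReal_zero] at h3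
    exact h3.comp h

lemma isPosContraction_idC₀ : IsPosContraction idC₀ := by
  refine ⟨⟨sqrtC₀, ?_⟩, ?_⟩
  · ext t
    have h : ((t : ℝ) : ℂ) = ((Real.sqrt t * Real.sqrt t : ℝ) : ℂ) := by
      rw [Real.mul_self_sqrt t.2.1.le]
    rw [ZeroAtInftyContinuousMap.mul_apply, ZeroAtInftyContinuousMap.star_apply]
    change ((t : ℝ) : ℂ) = star ((Real.sqrt t : ℝ) : ℂ) * ((Real.sqrt t : ℝ) : ℂ)
    rw [h, Complex.star_def, Complex.conj_ofReal, Complex.ofReal_mul]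
  · rw [← ZeroAtInftyContinuousMap.norm_toBCF_eq_norm]
    refine (BoundedContinuousFunction.norm_le zero_le_one).2 fun t => ?_
    change ‖((t : ℝ) : ℂ)‖ ≤ 1
    rw [Complex.norm_real, Real.norm_of_nonneg t.2.1.le]
    exact t.2.2

/-- Evaluation at a point, as a homomorphism on `C₀(0,1]`. -/
noncomputable def evalC₀ (t : Set.Ioc (0 : ℝ) 1) : C₀(Set.Ioc (0 : ℝ) 1, ℂ) →⋆ₙₐ[ℂ] ℂ where
  toFun f := f t
  map_smul' _ _ := rfl
  map_zero' := rfl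
  map_add' _ _ := rfl
  map_mul' _ _ := rfl
  map_star' _ := rfl

/-- Evaluation at `t` is a homomorphism, so it commutes with the functional calculus, which on the
scalar `t` is evaluation of the function at `t`. -/
lemma cfcₙ_extendZero_idC₀ (f : C₀(Set.Ioc (0 : ℝ) 1, ℂ)) : cfcₙ (extendZero f) idC₀ = f := by
  ext t
  have hi := isPosContraction_idC₀
  have hn : IsStarNormal idC₀ := hi.isSelfAdjoint.isStarNormal
  have ht := hi.map (evalC₀ t)
  have h1 : evalC₀ t (cfcₙ (extendZero f) idC₀) = cfcₙ (extendZero f) (evalC₀ t idC₀) :=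
    NonUnitalStarAlgHomClass.map_cfcₙ (S := ℂ) (evalC₀ t) _ _ (hi.continuousOn_extendZero f)
      (extendZero_zero f) (map_continuous _) hn ht.isSelfAdjoint.isStarNormal
  have h2 : evalC₀ t idC₀ = algebraMap ℂ ℂ ((t : ℝ) : ℂ) := rfl
  refine h1.trans ?_
  rw [cfcₙ_eq_cfc (ht.continuousOn_extendZero f) (extendZero_zero f), h2, cfc_algebraMap]
  exact extendZero_coe f t

lemma mem_of_idC₀_mem {S : NonUnitalStarSubalgebra ℂ C₀(Set.Ioc (0 : ℝ) 1, ℂ)}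
    (hS : IsClosed (S : Set C₀(Set.Ioc (0 : ℝ) 1, ℂ))) (h : idC₀ ∈ S)
    (f : C₀(Set.Ioc (0 : ℝ) 1, ℂ)) : f ∈ S := by
  rw [← cfcₙ_extendZero_idC₀ f]
  exact NonUnitalStarAlgebra.elemental.le_of_mem hS h (cfcₙ_mem_elemental _ _)

/-! ### Closed subalgebras containing the generators, and maps out of `ℂ ∗ C₀(0,1]` -/

/-- Since `cstarGen f` is closed in `B`, the image of `S` in `B` is still closed, so minimality of
the closure applies there. -/
lemma mem_of_generators_mem {G : Type w} {B : Type v} [NonUnitalCStarAlgebra B] (f : G → B)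
    {S : NonUnitalStarSubalgebra ℂ (cstarGen f)} (hS : IsClosed (S : Set (cstarGen f)))
    (h : ∀ g, (⟨f g, mem_cstarGen f g⟩ : cstarGen f) ∈ S) (a : cstarGen f) : a ∈ S := by
  let ι := NonUnitalStarSubalgebraClass.subtype (cstarGen f)
  have hcl : IsClosed (S.map ι : Set B) :=
    (show IsClosed (cstarGen f : Set B) from inferInstance).isClosedEmbedding_subtypeVal.isClosedMap
      _ hS
  have hle : cstarGen f ≤ S.map ι := by
    refine NonUnitalStarSubalgebra.topologicalClosure_minimal _
      (NonUnitalStarAlgebra.adjoin_le ?_) hcl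
    rintro _ ⟨g, rfl⟩
    exact ⟨_, h g, rfl⟩
  obtain ⟨b, hb, hba⟩ := hle a.2
  rwa [← Subtype.ext hba]

lemma AlgP.mem_of_generators_mem {S : NonUnitalStarSubalgebra ℂ AlgP}
    (hS : IsClosed (S : Set AlgP)) (hh : AlgP.h ∈ S) (hk : AlgP.k ∈ S) (hx : AlgP.x ∈ S)
    (a : AlgP) : a ∈ S := by
  refine _root_.mem_of_generators_mem PRep.generator (S := S) hS (fun g => ?_) a
  fin_cases g
  exacts [hh, hk, hx]

namespace FreeProductCC₀

lemma mem_of_generators_mem {S : NonUnitalStarSubalgebra ℂ FreeProductCC₀}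
    (hS : IsClosed (S : Set FreeProductCC₀)) (hp : p ∈ S) (hl : l ∈ S) (a : FreeProductCC₀) :
    a ∈ S := by
  refine _root_.mem_of_generators_mem (FreeProductRep.generator ℂ C₀(Set.Ioc (0 : ℝ) 1, ℂ))
    (S := S) hS (fun g => ?_) a
  rcases g with c | f
  · have h : (CStarFreeProduct.inl c : FreeProductCC₀) = c • p := by
      rw [p, ← map_smul, smul_eq_mul, mul_one]
    change (CStarFreeProduct.inl c : FreeProductCC₀) ∈ S
    rw [h]
    exact S.smul_mem c hp
  · exact mem_of_idC₀_mem (S := S.comap CStarFreeProduct.inr)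
      (hS.preimage (map_continuous CStarFreeProduct.inr)) hl f

lemma hom_ext {C : Type*} [NonUnitalCStarAlgebra C] {φ ψ : FreeProductCC₀ →⋆ₙₐ[ℂ] C}
    (hp : φ p = ψ p) (hl : φ l = ψ l) : φ = ψ := by
  ext a
  exact mem_of_generators_mem (S := NonUnitalStarAlgHom.equalizer φ ψ)
    (isClosed_eq (map_continuous φ) (map_continuous ψ)) hp hl a

lemma star_p : star p = p := by
  rw [p, ← map_star, star_one]

lemma p_mul_p : p * p = p := by
  rw [p, ← map_mul, one_mul]

lemma isPosContraction_l : IsPosContraction l :=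
  isPosContraction_idC₀.map CStarFreeProduct.inr

lemma exists_hom {A : Type*} [NonUnitalCStarAlgebra A] {q a : A} (hq : star q = q)
    (hqq : q * q = q) (ha : IsPosContraction a) :
    ∃ χ : FreeProductCC₀ →⋆ₙₐ[ℂ] A, χ p = q ∧ χ l = a := by
  let φ : ℂ →⋆ₙₐ[ℂ] A :=
    { toFun := fun c => c • q
      map_smul' := fun c d => smul_assoc c d q
      map_zero' := zero_smul ℂ q
      map_add' := fun c d => add_smul c d q
      map_mul' := fun c d => by rw [smul_mul_smul_comm, hqq]
      map_star' := fun c => by rw [star_smul, hq] }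
  obtain ⟨χ, ⟨h1, h2⟩, -⟩ := CStarFreeProduct.existsUnique_hom φ ha.cfcC₀
  refine ⟨χ, ?_, ?_⟩
  · exact (DFunLike.congr_fun h1 1).trans (one_smul ℂ q)
  · exact (DFunLike.congr_fun h2 idC₀).trans ha.cfcC₀_idC₀

end FreeProductCC₀

/-! ### The relations of `𝒫` from a projection and a positive contraction -/

lemma isPosContraction_of_nonneg {A : Type*} [CStarAlgebra A] [PartialOrder A]
    [StarOrderedRing A] {a : A} (h0 : 0 ≤ a) (h1 : 0 ≤ 1 - a) : IsPosContraction a :=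
  ⟨nonneg_iff_star_mul_self.1 h0,
    (CStarAlgebra.norm_le_one_iff_of_nonneg a h0).2 (sub_nonneg.1 h1)⟩

/-- A matrix whose entries are `q a (1 - q)`-corners of a positive contraction satisfies
`0 ≤ P ≤ 1` after adding the projection `1 - q` in the upper left entry. -/
lemma matrixZeroLeOne_of_projection {A : Type*} [CStarAlgebra A] {q a : A} (hq : star q = q)
    (hqq : q * q = q) (ha : IsPosContraction a) :
    MatrixZeroLeOne !![1 - (q - q * a * q), q * a * (1 - q);
      (1 - q) * a * q, (1 - q) * a * (1 - q)] := by
  let _ := CStarAlgebra.spectralOrder A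
  let _ := CStarAlgebra.spectralOrderedRing A
  obtain ⟨s, hs⟩ := ha.exists_star_mul
  have h0 : 0 ≤ a := nonneg_iff_star_mul_self.2 ⟨s, hs⟩
  obtain ⟨r, hr⟩ := nonneg_iff_star_mul_self.1
    (sub_nonneg.2 ((CStarAlgebra.norm_le_one_iff_of_nonneg a h0).1 ha.norm_le_one))
  have hq' : star (1 - q) = 1 - q := by rw [star_sub, star_one, hq]
  have hqq' : (1 - q) * (1 - q) = 1 - q := by
    simp only [mul_sub, sub_mul, hqq, mul_one, one_mul, sub_self, sub_zero]
  have key : ∀ t u v : A, star (t * u) * (t * v) = star u * (star t * t) * v := by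
    intro t u v; rw [star_mul]; noncomm_ring
  -- With `a = s⋆s` and `1 - a = r⋆r`, the first rows give the corners of `a` and of `1 - a`; the
  -- second rows add `1 - q` in the upper left and `q` in the lower right entry.
  refine ⟨⟨!![s * q, s * (1 - q); 1 - q, 0], ?_⟩, ⟨!![r * q, r * (1 - q); 0, q], ?_⟩⟩
  · refine Matrix.ext fun i j => ?_
    fin_cases i <;> fin_cases j <;>
      simp only [Matrix.mul_apply, Fin.sum_univ_two, Matrix.conjTranspose_apply, Fin.zero_eta,
        Fin.mk_one, Matrix.of_apply, Matrix.cons_val', Matrix.cons_val_zero, Matrix.cons_val_one,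
        Matrix.cons_val_fin_one, Fin.isValue, key, ← hs, hq, hq', hqq', star_zero, mul_zero,
        zero_mul, add_zero]
    noncomm_ring
  · refine Matrix.ext fun i j => ?_
    fin_cases i <;> fin_cases j <;>
      simp only [Matrix.mul_apply, Fin.sum_univ_two, Matrix.conjTranspose_apply, Fin.zero_eta,
        Fin.mk_one, Matrix.of_apply, Matrix.cons_val', Matrix.cons_val_zero, Matrix.cons_val_one,
        Matrix.cons_val_fin_one, Fin.isValue, key, ← hr, hq, hq', hqq, star_zero, mul_zero,
        zero_mul, add_zero, Matrix.sub_apply, Matrix.one_apply_eq, zero_sub, ne_eq, one_ne_zero,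
        zero_ne_one, not_false_eq_true, Matrix.one_apply_ne]
    all_goals noncomm_ring
    all_goals simp only [hqq, ← mul_assoc]
    all_goals noncomm_ring

/-- The formulas for `k` and `x` are read in the unitization because `1 - q` need not lie in `B`;
the factor `q(1 - q) = 0` gives `hk = 0`. -/
lemma isPTriple_of_projection {B : Type*} [NonUnitalCStarAlgebra B] {q a h k x : B}
    (hq : star q = q) (hqq : q * q = q) (ha : IsPosContraction a) (hh : h = q - q * a * q)
    (hk : (k : Unitization ℂ B) = (1 - (q : Unitization ℂ B)) * a * (1 - (q : Unitization ℂ B)))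
    (hx : (x : Unitization ℂ B) = (1 - (q : Unitization ℂ B)) * a * q) : IsPTriple h k x := by
  let ι := Unitization.inrNonUnitalStarAlgHom ℂ B
  have hh' : (h : Unitization ℂ B) = (q : Unitization ℂ B) - q * a * q := by
    rw [hh]; simp
  have hq' : star (q : Unitization ℂ B) = q := by
    rw [← Unitization.inr_star, hq]
  have hqq' : (q : Unitization ℂ B) * q = q := by rw [← Unitization.inr_mul, hqq]
  have ha' : star (a : Unitization ℂ B) = a := by
    rw [← Unitization.inr_star, ha.isSelfAdjoint.star_eq]
  refine ⟨Unitization.inr_injective (R := ℂ) ?_, ?_⟩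
  · rw [Unitization.inr_mul, hk, hh', Unitization.inr_zero]
    have : (q : Unitization ℂ B) * (1 - q) = 0 := by rw [mul_sub, mul_one, hqq', sub_self]
    rw [← mul_assoc, ← mul_assoc, sub_mul, this, mul_assoc _ (q : Unitization ℂ B), this]
    simp
  · have h1 := matrixZeroLeOne_of_projection hq' hqq' (ha.map ι)
    have hx' : ((star x : B) : Unitization ℂ B) = (q : Unitization ℂ B) * a * (1 - q) := by
      rw [Unitization.inr_star, hx]
      simp only [star_mul, star_sub, star_one, hq', ha', mul_assoc]
    rw [relationMatrix, hh', hk, hx, hx']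
    exact h1

/-! ### Diagonal entries of a positive matrix control their columns -/

section EntryEstimates

variable {A : Type*} [CStarAlgebra A]

/-- A Cauchy–Schwarz estimate: `M j j` is the sum of the `(Y m j)⋆ (Y m j)` and dominates each of
them, so it bounds every `Y m j * w`, while `M i j * w` is the sum of the `(Y m i)⋆ (Y m j * w)`. -/
lemma norm_entry_mul_sq_le {M Y : Matrix (Fin 2) (Fin 2) A} (hM : M = Y.conjTranspose * Y)
    (i j : Fin 2) (w : A) :
    ‖M i j * w‖ ^ 2 ≤ (‖Y 0 i‖ + ‖Y 1 i‖) ^ 2 * ‖star w * M j j * w‖ := by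
  let _ := CStarAlgebra.spectralOrder A
  let _ := CStarAlgebra.spectralOrderedRing A
  have hMij : ∀ i j, M i j = star (Y 0 i) * Y 0 j + star (Y 1 i) * Y 1 j := by
    intro i j
    rw [hM, Matrix.mul_apply, Fin.sum_univ_two]
    rfl
  have hsq : ∀ m, ‖Y m j * w‖ ^ 2 ≤ ‖star w * M j j * w‖ := by
    intro m
    rw [sq, ← CStarRing.norm_star_mul_self]
    refine CStarAlgebra.norm_le_norm_of_nonneg_of_le (star_mul_self_nonneg _) ?_
    have e : star (Y m j * w) * (Y m j * w) = star w * (star (Y m j) * Y m j) * w := by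
      rw [star_mul]; noncomm_ring
    rw [e]
    refine star_left_conjugate_le_conjugate ?_ w
    rw [hMij]
    fin_cases m
    · exact le_add_of_nonneg_right (star_mul_self_nonneg _)
    · exact le_add_of_nonneg_left (star_mul_self_nonneg _)
  set b := ‖star w * M j j * w‖
  have hb : 0 ≤ b := norm_nonneg _
  have hle : ‖M i j * w‖ ≤ (‖Y 0 i‖ + ‖Y 1 i‖) * Real.sqrt b := by
    have hm : ∀ m, ‖star (Y m i) * (Y m j * w)‖ ≤ ‖Y m i‖ * Real.sqrt b := by
      intro m
      refine (norm_mul_le _ _).trans ?_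
      rw [norm_star]
      exact mul_le_mul_of_nonneg_left (Real.le_sqrt_of_sq_le (hsq m)) (norm_nonneg _)
    rw [hMij, add_mul, mul_assoc, mul_assoc, add_mul]
    exact (norm_add_le _ _).trans (add_le_add (hm 0) (hm 1))
  calc ‖M i j * w‖ ^ 2 ≤ ((‖Y 0 i‖ + ‖Y 1 i‖) * Real.sqrt b) ^ 2 :=
        pow_le_pow_left₀ (norm_nonneg _) hle 2
    _ = _ := by rw [mul_pow, Real.sq_sqrt hb]

lemma entry_mul_eq_zero {M Y : Matrix (Fin 2) (Fin 2) A} (hM : M = Y.conjTranspose * Y)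
    (i : Fin 2) {j : Fin 2} {w : A} (h : M j j * w = 0) : M i j * w = 0 := by
  have h1 := norm_entry_mul_sq_le hM i j w
  rw [mul_assoc, h, mul_zero, norm_zero, mul_zero] at h1
  exact norm_eq_zero.1 (pow_eq_zero_iff two_ne_zero |>.1 (le_antisymm h1 (sq_nonneg _)))

lemma tendsto_entry_mul {M Y : Matrix (Fin 2) (Fin 2) A} (hM : M = Y.conjTranspose * Y)
    (i j : Fin 2) {w : ℕ → A}
    (h : Filter.Tendsto (fun n => star (w n) * M j j * w n) Filter.atTop (nhds 0)) :
    Filter.Tendsto (fun n => M i j * w n) Filter.atTop (nhds 0) := by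
  rw [tendsto_zero_iff_norm_tendsto_zero] at h ⊢
  have h2 : Filter.Tendsto (fun n => ‖M i j * w n‖ ^ 2) Filter.atTop (nhds 0) := by
    refine squeeze_zero (fun n => sq_nonneg _) (fun n => norm_entry_mul_sq_le hM i j (w n)) ?_
    simpa using h.const_mul ((‖Y 0 i‖ + ‖Y 1 i‖) ^ 2)
  have h3 := (Real.continuous_sqrt.tendsto 0).comp h2
  simpa [Function.comp_def, Real.sqrt_sq (norm_nonneg _)] using h3

lemma star_entry {M Y : Matrix (Fin 2) (Fin 2) A} (hM : M = Y.conjTranspose * Y) (i j : Fin 2) :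
    star (M i j) = M j i := by
  have : M.conjTranspose = M := by
    rw [hM, Matrix.conjTranspose_mul, Matrix.conjTranspose_conjTranspose]
  exact congrFun (congrFun this j) i

/-- The compression of a positive matrix by a column with selfadjoint entries. -/
lemma compression_nonneg [PartialOrder A] [StarOrderedRing A] {M Y : Matrix (Fin 2) (Fin 2) A}
    (hM : M = Y.conjTranspose * Y) {q r : A} (hq : star q = q) (hr : star r = r) :
    0 ≤ q * M 0 0 * q + q * M 0 1 * r + r * M 1 0 * q + r * M 1 1 * r := by
  have hMij : ∀ i j, M i j = star (Y 0 i) * Y 0 j + star (Y 1 i) * Y 1 j := by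
    intro i j
    rw [hM, Matrix.mul_apply, Fin.sum_univ_two]
    rfl
  have e : q * M 0 0 * q + q * M 0 1 * r + r * M 1 0 * q + r * M 1 1 * r =
      star (Y 0 0 * q + Y 0 1 * r) * (Y 0 0 * q + Y 0 1 * r) +
      star (Y 1 0 * q + Y 1 1 * r) * (Y 1 0 * q + Y 1 1 * r) := by
    simp only [hMij, star_add, star_mul, hq, hr]
    noncomm_ring
  rw [e]
  exact add_nonneg (star_mul_self_nonneg _) (star_mul_self_nonneg _)

end EntryEstimates

/-! ### Approximate support of a selfadjoint element -/

/-- A selfadjoint element has an approximate support: contractions `u n` that are multiples of `h`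
and such that `(1 - u n) h (1 - u n)` tends to zero. -/
lemma exists_approximate_support {A : Type*} [NonUnitalCStarAlgebra A] {h : A}
    (hh : IsSelfAdjoint h) :
    ∃ u v : ℕ → A, (∀ n, star (u n) = u n) ∧ (∀ n, ‖u n‖ ≤ 1) ∧ (∀ n, u n = v n * h) ∧
      (∀ n, u n = h * v n) ∧
      Filter.Tendsto (fun n => h - u n * h - h * u n + u n * h * u n) Filter.atTop (nhds 0) := by
  -- `v n` is `g n` applied to `h`, and `u n` is `n²t²/(1 + n²t²)` applied to `h`; the latter tends
  -- to the indicator function of `t ≠ 0`.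
  let g : ℕ → ℝ → ℝ := fun n t => n ^ 2 * t / (1 + n ^ 2 * t ^ 2)
  have hpos : ∀ (n : ℕ) (t : ℝ), 0 < 1 + (n : ℝ) ^ 2 * t ^ 2 := fun n t => by positivity
  have hg : ∀ n, Continuous (g n) := fun n =>
    Continuous.div (by fun_prop) (by fun_prop) fun t => (hpos n t).ne'
  have hg0 : ∀ n, g n 0 = 0 := fun n => by simp [g]
  have hf : ∀ n, Continuous fun t => g n t * t := fun n => (hg n).mul continuous_id
  have hf0 : ∀ n, g n 0 * 0 = 0 := fun n => mul_zero _
  have huv : ∀ n, cfcₙ (fun t => g n t * t) h = cfcₙ (g n) h * h := by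
    intro n
    rw [cfcₙ_mul (g n) (fun t => t) h (hg n).continuousOn (hg0 n), cfcₙ_id' ℝ h]
  refine ⟨fun n => cfcₙ (fun t => g n t * t) h, fun n => cfcₙ (g n) h, fun n => ?_, fun n => ?_,
    huv, fun n => ?_, ?_⟩
  · exact (IsSelfAdjoint.cfcₙ (f := fun t => g n t * t) (a := h)).star_eq
  · refine norm_cfcₙ_le fun t _ => ?_
    have e : g n t * t = n ^ 2 * t ^ 2 / (1 + n ^ 2 * t ^ 2) := by simp only [g]; ring
    rw [e, Real.norm_of_nonneg (by positivity), div_le_one (hpos n t)]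
    linarith
  · have e : (fun t => g n t * t) = fun t => t * g n t := by ext t; ring
    change cfcₙ (fun t => g n t * t) h = _
    rw [e, cfcₙ_mul (fun t => t) (g n) h continuous_id.continuousOn rfl (hg n).continuousOn
      (hg0 n), cfcₙ_id' ℝ h]
  · have e : ∀ n, h - cfcₙ (fun t => g n t * t) h * h - h * cfcₙ (fun t => g n t * t) h +
        cfcₙ (fun t => g n t * t) h * h * cfcₙ (fun t => g n t * t) h =
        cfcₙ (fun t => t - g n t * t * t - t * (g n t * t) + g n t * t * t * (g n t * t)) h := by
      intro n
      have hc1 := (hf n).continuousOn (s := quasispectrum ℝ h)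
      have hc2 : ContinuousOn (fun t : ℝ => t) (quasispectrum ℝ h) := continuousOn_id
      have e1 := cfcₙ_mul (fun t => g n t * t) (fun t => t) h hc1 (hf0 n) hc2 rfl
      have e2 := cfcₙ_mul (fun t => t) (fun t => g n t * t) h hc2 rfl hc1 (hf0 n)
      have e3 := cfcₙ_mul (fun t => g n t * t * t) (fun t => g n t * t) h (hc1.mul hc2) (by simp)
        hc1 (hf0 n)
      have e4 := cfcₙ_sub (fun t => t) (fun t => g n t * t * t) h hc2 rfl (hc1.mul hc2) (by simp)
      have e5 := cfcₙ_sub (fun t => t - g n t * t * t) (fun t => t * (g n t * t)) h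
        (hc2.sub (hc1.mul hc2)) (by simp) (hc2.mul hc1) (by simp)
      have e6 := cfcₙ_add (f := fun t => t - g n t * t * t - t * (g n t * t))
        (g := fun t => g n t * t * t * (g n t * t)) (a := h)
        (hf := (hc2.sub (hc1.mul hc2)).sub (hc2.mul hc1)) (hf0 := by simp)
        (hg := (hc1.mul hc2).mul hc1) (hg0 := by simp)
      rw [e6, e5, e4, e3, e2, e1, cfcₙ_id' ℝ h]
    simp only [e]
    refine squeeze_zero_norm' (a := fun n : ℕ => 1 / (n : ℝ)) ?_ tendsto_one_div_atTop_nhds_zero_nat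
    filter_upwards [Filter.eventually_gt_atTop 0] with n hn
    have hn' : (0 : ℝ) < n := Nat.cast_pos.2 hn
    refine norm_cfcₙ_le fun t _ => ?_
    -- The left side is `t (1 - g n t * t)²`, and `1 - g n t * t = 1/(1 + n²t²)`.
    have e' : t - g n t * t * t - t * (g n t * t) + g n t * t * t * (g n t * t) =
        t / (1 + n ^ 2 * t ^ 2) ^ 2 := by
      have := (hpos n t).ne'
      simp only [g]
      field_simp
      ring
    rw [e', Real.norm_eq_abs, abs_div, abs_of_pos (pow_pos (hpos n t) 2),
      div_le_div_iff₀ (pow_pos (hpos n t) 2) hn']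
    have h2 : |t| ^ 2 = t ^ 2 := sq_abs t
    have h3 : 0 ≤ (n : ℝ) ^ 2 * t ^ 2 := by positivity
    -- From `2n|t| ≤ 1 + n²t²` one gets `n|t| ≤ (1 + n²t²)²`, which is the bound by `1/n`.
    nlinarith [sq_nonneg ((n : ℝ) * |t| - 1), mul_self_nonneg ((n : ℝ) ^ 2 * t ^ 2)]

/-! ### Multipliers as strict limits, and the embedding of an algebra in its multipliers -/

section Multipliers

variable {A : Type*} [NonUnitalCStarAlgebra A]

/-- A bounded selfadjoint sequence converging strictly defines a multiplier. -/
lemma DoubleCentralizer.exists_of_tendsto {u : ℕ → A} (hu : ∀ n, star (u n) = u n)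
    (hlim : ∀ a, ∃ b, Filter.Tendsto (fun n => u n * a) Filter.atTop (nhds b)) :
    ∃ m : DoubleCentralizer ℂ A, star m = m ∧
      ∀ a, Filter.Tendsto (fun n => u n * a) Filter.atTop (nhds (m.fst a)) := by
  choose L hL using hlim
  have hR : ∀ a, Filter.Tendsto (fun n => a * u n) Filter.atTop (nhds (star (L (star a)))) := by
    intro a
    have := (hL (star a)).star
    simpa only [star_mul, hu, star_star] using this
  -- The pointwise limits are bounded operators by the Banach–Steinhaus theorem.
  let Lc : A →L[ℂ] A := continuousLinearMapOfTendsto (l := Filter.atTop)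
    (fun n => ContinuousLinearMap.mul ℂ A (u n)) (tendsto_pi_nhds.2 hL)
  let Rc : A →L[ℂ] A := continuousLinearMapOfTendsto (l := Filter.atTop)
    (fun n => (ContinuousLinearMap.mul ℂ A).flip (u n)) (tendsto_pi_nhds.2 hR)
  have hLc : ∀ a, Lc a = L a := fun _ => rfl
  have hRc : ∀ a, Rc a = star (L (star a)) := fun _ => rfl
  refine ⟨⟨(Lc, Rc), fun a b => ?_⟩, ?_, hL⟩
  · refine tendsto_nhds_unique ((hR a).mul_const b) ?_
    simp only [mul_assoc]
    exact (hL b).const_mul a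
  · refine DoubleCentralizer.ext _ _ _ _ (Prod.ext ?_ ?_)
    · ext a
      rw [DoubleCentralizer.star_fst]
      change star (Rc (star a)) = Lc a
      rw [hRc, hLc, star_star, star_star]
    · ext a
      rw [DoubleCentralizer.star_snd]
      change star (Lc (star a)) = Rc a
      rw [hRc, hLc]

lemma DoubleCentralizer.mul_coeHom (m : DoubleCentralizer ℂ A) (a : A) :
    m * DoubleCentralizer.coeHom a = DoubleCentralizer.coeHom (m.fst a) := by
  refine DoubleCentralizer.ext _ _ _ _ (Prod.ext ?_ ?_)
  · ext b
    rw [DoubleCentralizer.mul_fst]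
    change m.fst (a * b) = m.fst a * b
    -- Centrality moves `m` only across a product, hence the extra left factor `c`; taking for `c`
    -- the adjoint of the difference removes it by the C⋆-identity.
    have h : ∀ c, c * (m.fst (a * b) - m.fst a * b) = 0 := by
      intro c
      rw [mul_sub, ← mul_assoc, ← m.central, ← m.central, mul_assoc, sub_self]
    exact sub_eq_zero.1 ((CStarRing.star_mul_self_eq_zero_iff _).1 (h _))
  · ext b
    rw [DoubleCentralizer.mul_snd]
    change m.snd b * a = b * m.fst a
    exact m.central b a

lemma DoubleCentralizer.coeHom_injective :
    Function.Injective (DoubleCentralizer.coeHom (𝕜 := ℂ) (A := A)) := by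
  rw [injective_iff_map_eq_zero]
  intro a ha
  have h : a * star a = 0 := by
    have := congrArg (fun m : DoubleCentralizer ℂ A => m.fst (star a)) ha
    exact this
  exact CStarRing.mul_star_self_eq_zero_iff a |>.1 h

lemma DoubleCentralizer.eq_zero_of_mul_coeHom {m : DoubleCentralizer ℂ A}
    (h : ∀ a, m * DoubleCentralizer.coeHom a = 0) : m = 0 := by
  have : m.fst = 0 := by
    ext a
    have := h a
    rw [DoubleCentralizer.mul_coeHom] at this
    exact DoubleCentralizer.coeHom_injective (this.trans (map_zero _).symm)
  rw [← norm_eq_zero, ← DoubleCentralizer.norm_fst, this, norm_zero]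

end Multipliers

/-! ### Consequences of the relations -/

section PTriple

variable {B : Type*} [NonUnitalCStarAlgebra B] {h k x : B}

namespace IsPTriple

lemma star_h (H : IsPTriple h k x) : star h = h := by
  obtain ⟨Y, hY⟩ := H.zero_le_one.nonneg
  have e : star (1 - (h : Unitization ℂ B)) = 1 - (h : Unitization ℂ B) := star_entry hY 0 0
  rw [star_sub, star_one, sub_right_inj, ← Unitization.inr_star] at e
  exact Unitization.inr_injective e

lemma star_k (H : IsPTriple h k x) : star k = k := by
  obtain ⟨Y, hY⟩ := H.zero_le_one.nonneg
  have e : star (k : Unitization ℂ B) = (k : Unitization ℂ B) := star_entry hY 1 1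
  rw [← Unitization.inr_star] at e
  exact Unitization.inr_injective e

lemma k_mul_h (H : IsPTriple h k x) : k * h = 0 := by
  rw [← H.star_h, ← H.star_k, ← star_mul, H.mul_eq_zero, star_zero]

/-- The second column of `P` is `(x⋆, k)` with diagonal entry `k`, so whatever `k` annihilates on
its right is annihilated by `x⋆` too. With `w = h` this yields `hx = 0`. -/
lemma star_x_mul_eq_zero (H : IsPTriple h k x) {w : B} (hw : k * w = 0) : star x * w = 0 := by
  obtain ⟨Y, hY⟩ := H.zero_le_one.nonneg
  have e : ((star x : B) : Unitization ℂ B) * w = 0 :=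
    entry_mul_eq_zero hY 0 (j := 1) (w := (w : Unitization ℂ B)) (by
      change (k : Unitization ℂ B) * w = 0
      rw [← Unitization.inr_mul, hw, Unitization.inr_zero])
  rw [← Unitization.inr_mul] at e
  exact Unitization.inr_injective e

lemma h_mul_x (H : IsPTriple h k x) : h * x = 0 := by
  have e := congrArg star (H.star_x_mul_eq_zero H.k_mul_h)
  rwa [star_mul, star_star, H.star_h, star_zero] at e

lemma one_sub_zero_zero : (1 - relationMatrix h k x) 0 0 = (h : Unitization ℂ B) := by
  change 1 - (1 - (h : Unitization ℂ B)) = h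
  exact sub_sub_cancel _ _

lemma one_sub_one_zero : (1 - relationMatrix h k x) 1 0 = -(x : Unitization ℂ B) := by
  change 0 - (x : Unitization ℂ B) = -x
  exact zero_sub _

/-- The first column of `1 - P` is `(h, -x)` with diagonal entry `h`. For `w = 1 - u n` the
hypothesis says `w⋆hw → 0`; the column estimate gives `hw → 0` and `xw → 0`, and adjoints give the
claim. Thus an approximate support of `h` also supports `x⋆`, although `x⋆` need not be a multiple
of `h`. -/
lemma tendsto_mul_support (H : IsPTriple h k x) {u : ℕ → B} (hu : ∀ n, star (u n) = u n)
    (hlim : Filter.Tendsto (fun n => h - u n * h - h * u n + u n * h * u n) Filter.atTop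
      (nhds 0)) :
    Filter.Tendsto (fun n => u n * h) Filter.atTop (nhds h) ∧
      Filter.Tendsto (fun n => u n * star x) Filter.atTop (nhds (star x)) := by
  obtain ⟨Z, hZ⟩ := H.zero_le_one.le_one
  let w : ℕ → Unitization ℂ B := fun n => 1 - u n
  have hw : Filter.Tendsto (fun n => star (w n) * (1 - relationMatrix h k x) 0 0 * w n)
      Filter.atTop (nhds 0) := by
    have e : ∀ n, star (w n) * (1 - relationMatrix h k x) 0 0 * w n =
        ((h - u n * h - h * u n + u n * h * u n : B) : Unitization ℂ B) := by
      intro n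
      simp only [w, one_sub_zero_zero, star_sub, star_one, ← Unitization.inr_star, hu,
        Unitization.inr_add, Unitization.inr_sub, Unitization.inr_mul]
      noncomm_ring
    simp only [e]
    rw [tendsto_zero_iff_norm_tendsto_zero] at hlim ⊢
    simpa only [Unitization.norm_inr] using hlim
  have back : ∀ {a : B}, Filter.Tendsto (fun n => (a : Unitization ℂ B) * w n) Filter.atTop
      (nhds 0) → Filter.Tendsto (fun n => u n * star a) Filter.atTop (nhds (star a)) := by
    intro a ha
    have e : ∀ n, (a : Unitization ℂ B) * w n = ((a - a * u n : B) : Unitization ℂ B) := by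
      intro n
      simp only [w, Unitization.inr_sub, Unitization.inr_mul, mul_sub, mul_one]
    simp only [e] at ha
    rw [tendsto_zero_iff_norm_tendsto_zero] at ha
    simp only [Unitization.norm_inr] at ha
    rw [← tendsto_zero_iff_norm_tendsto_zero] at ha
    have h2 := (ha.const_sub a).star
    simpa only [sub_sub_cancel, sub_zero, star_mul, hu] using h2
  constructor
  · have h1 := tendsto_entry_mul hZ 0 0 hw
    rw [one_sub_zero_zero] at h1
    have h2 := back h1
    rwa [H.star_h] at h2
  · have h1 := (tendsto_entry_mul hZ 1 0 hw).neg
    simp only [one_sub_one_zero, neg_mul, neg_neg, neg_zero] at h1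
    exact back h1

end IsPTriple

end PTriple

/-- The set of elements on which left multiplication by a bounded sequence converges is closed. -/
lemma isClosed_setOf_exists_tendsto_mul {A : Type*} [NonUnitalCStarAlgebra A] {u : ℕ → A}
    (hu : ∀ n, ‖u n‖ ≤ 1) :
    IsClosed {a : A | ∃ b, Filter.Tendsto (fun n => u n * a) Filter.atTop (nhds b)} := by
  refine isClosed_of_closure_subset fun a ha => cauchySeq_tendsto_of_complete ?_
  rw [Metric.cauchySeq_iff]
  intro ε hε
  obtain ⟨a', ⟨b, hb⟩, hd⟩ := Metric.mem_closure_iff.1 ha (ε / 3) (by linarith)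
  obtain ⟨N, hN⟩ := Metric.cauchySeq_iff.1 hb.cauchySeq (ε / 3) (by linarith)
  have key : ∀ n, dist (u n * a) (u n * a') < ε / 3 := by
    intro n
    rw [dist_eq_norm, ← mul_sub]
    refine ((norm_mul_le _ _).trans (mul_le_of_le_one_left (norm_nonneg _) (hu n))).trans_lt ?_
    rwa [← dist_eq_norm]
  refine ⟨N, fun m hm n hn => ?_⟩
  have h1 := dist_triangle4 (u m * a) (u m * a') (u n * a') (u n * a)
  have h2 := key m
  have h3 := key n
  have h4 := hN m hm n hn
  rw [dist_comm] at h3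
  linarith

/-! ### The support projection of `h` and the left inverse of `θ` up to multipliers -/

namespace AlgP

/-- The elements lying in `R` together with their adjoints form a closed `*`-subalgebra. This
reduces properties of left multiplication, such as annihilation or convergence, to the four elements
`h`, `k`, `x`, `x⋆`. -/
lemma mem_of_right_ideal {R : Submodule ℂ AlgP} (hR : IsClosed (R : Set AlgP))
    (hmul : ∀ a b, a ∈ R → a * b ∈ R) (hh : h ∈ R) (hk : k ∈ R) (hx : x ∈ R)
    (hx' : star x ∈ R) (a : AlgP) : a ∈ R := by
  let S : NonUnitalStarSubalgebra ℂ AlgP :=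
    { carrier := {a | a ∈ R ∧ star a ∈ R}
      add_mem' := fun ha hb => ⟨R.add_mem ha.1 hb.1, by
        rw [star_add]; exact R.add_mem ha.2 hb.2⟩
      zero_mem' := ⟨R.zero_mem, by rw [star_zero]; exact R.zero_mem⟩
      smul_mem' := fun c a ha => ⟨R.smul_mem c ha.1, by
        rw [star_smul]; exact R.smul_mem _ ha.2⟩
      mul_mem' := fun ha hb => ⟨hmul _ _ ha.1, by rw [star_mul]; exact hmul _ _ hb.2⟩
      star_mem' := fun ha => ⟨ha.2, by rw [star_star]; exact ha.1⟩ }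
  refine (mem_of_generators_mem (S := S) (hR.inter (hR.preimage continuous_star)) ⟨hh, ?_⟩
    ⟨hk, ?_⟩ ⟨hx, hx'⟩ a).1
  · rwa [isPTriple.star_h]
  · rwa [isPTriple.star_k]

/-- The embedding of `𝒫` into its multiplier algebra. -/
noncomputable abbrev toMultiplier : AlgP →⋆ₙₐ[ℂ] DoubleCentralizer ℂ AlgP :=
  DoubleCentralizer.coeHom

lemma multiplier_eq_zero {m : DoubleCentralizer ℂ AlgP} (hh : m * toMultiplier h = 0)
    (hk : m * toMultiplier k = 0) (hx : m * toMultiplier x = 0)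
    (hx' : m * toMultiplier (star x) = 0) : m = 0 := by
  let R : Submodule ℂ AlgP :=
    { carrier := {a | m * toMultiplier a = 0}
      add_mem' := fun {a b} ha hb => by
        change m * toMultiplier (a + b) = 0
        rw [map_add, mul_add, show m * toMultiplier a = 0 from ha,
          show m * toMultiplier b = 0 from hb, add_zero]
      zero_mem' := by
        change m * toMultiplier 0 = 0
        rw [map_zero, mul_zero]
      smul_mem' := fun c a ha => by
        change m * toMultiplier (c • a) = 0
        rw [map_smul, mul_smul_comm, show m * toMultiplier a = 0 from ha, smul_zero] }
  refine DoubleCentralizer.eq_zero_of_mul_coeHom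
    (mem_of_right_ideal (R := R) ?_ (fun a b ha => ?_) hh hk hx hx')
  · exact isClosed_eq ((map_continuous toMultiplier).const_mul m) continuous_const
  · change m * toMultiplier (a * b) = 0
    rw [map_mul, ← mul_assoc, show m * toMultiplier a = 0 from ha, zero_mul]

/-- The support projection of `h` exists as a multiplier of `𝒫`. -/
lemma exists_support_projection : ∃ q : DoubleCentralizer ℂ AlgP, star q = q ∧ q * q = q ∧
    q * toMultiplier h = toMultiplier h ∧ q * toMultiplier k = 0 ∧ q * toMultiplier x = 0 ∧
    q * toMultiplier (star x) = toMultiplier (star x) := by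
  have H := isPTriple
  obtain ⟨u, v, hu, hu1, huv, huv', hlim⟩ := exists_approximate_support (h := h) H.star_h
  obtain ⟨lim_h, lim_x'⟩ := H.tendsto_mul_support hu hlim
  -- Each `u n` ends in a right factor `h`, and `hk = hx = 0`, so these sequences are identically
  -- zero.
  have lim_k : Filter.Tendsto (fun n => u n * k) Filter.atTop (nhds 0) := by
    simp only [huv, mul_assoc, H.mul_eq_zero, mul_zero, tendsto_const_nhds]
  have lim_x : Filter.Tendsto (fun n => u n * x) Filter.atTop (nhds 0) := by
    simp only [huv, mul_assoc, H.h_mul_x, mul_zero, tendsto_const_nhds]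
  let R : Submodule ℂ AlgP :=
    { carrier := {a | ∃ b, Filter.Tendsto (fun n => u n * a) Filter.atTop (nhds b)}
      add_mem' := by
        rintro a a' ⟨b, hb⟩ ⟨b', hb'⟩
        exact ⟨b + b', by simpa only [mul_add] using hb.add hb'⟩
      zero_mem' := ⟨0, by simp only [mul_zero, tendsto_const_nhds]⟩
      smul_mem' := by
        rintro c a ⟨b, hb⟩
        exact ⟨c • b, by simpa only [mul_smul_comm] using hb.const_smul c⟩ }
  have hall : ∀ a, a ∈ R := by
    refine mem_of_right_ideal (R := R) (isClosed_setOf_exists_tendsto_mul hu1) ?_ ⟨_, lim_h⟩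
      ⟨_, lim_k⟩ ⟨_, lim_x⟩ ⟨_, lim_x'⟩
    rintro a a' ⟨b, hb⟩
    exact ⟨b * a', by simpa only [mul_assoc] using hb.mul_const a'⟩
  obtain ⟨q, hq, hqlim⟩ := DoubleCentralizer.exists_of_tendsto hu hall
  have hq_eq : ∀ {a b}, Filter.Tendsto (fun n => u n * a) Filter.atTop (nhds b) →
      q * toMultiplier a = toMultiplier b := by
    intro a b hb
    rw [DoubleCentralizer.mul_coeHom, tendsto_nhds_unique (hqlim a) hb]
  have qh := hq_eq lim_h
  have qk : q * toMultiplier k = 0 := (hq_eq lim_k).trans (map_zero _)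
  have qx : q * toMultiplier x = 0 := (hq_eq lim_x).trans (map_zero _)
  have qx' := hq_eq lim_x'
  refine ⟨q, hq, sub_eq_zero.1 (multiplier_eq_zero ?_ ?_ ?_ ?_), qh, qk, qx, qx'⟩
  · rw [sub_mul, mul_assoc, qh, qh, sub_self]
  · rw [sub_mul, mul_assoc, qk, mul_zero, sub_zero]
  · rw [sub_mul, mul_assoc, qx, mul_zero, sub_zero]
  · rw [sub_mul, mul_assoc, qx', qx', sub_self]

/-- The representation of `ℂ ∗ C₀(0,1]` by multipliers of `𝒫` that restricts to the canonical
embedding of `𝒫`. -/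
lemma exists_hom_multiplier :
    ∃ Ψ : FreeProductCC₀ →⋆ₙₐ[ℂ] DoubleCentralizer ℂ AlgP, ∀ θ : AlgP →⋆ₙₐ[ℂ] FreeProductCC₀,
      θ h = FreeProductCC₀.p - FreeProductCC₀.p * FreeProductCC₀.l * FreeProductCC₀.p →
      θ k = FreeProductCC₀.l - FreeProductCC₀.p * FreeProductCC₀.l -
        FreeProductCC₀.l * FreeProductCC₀.p +
        FreeProductCC₀.p * FreeProductCC₀.l * FreeProductCC₀.p →
      θ x = FreeProductCC₀.l * FreeProductCC₀.p -
        FreeProductCC₀.p * FreeProductCC₀.l * FreeProductCC₀.p →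
      Ψ.comp θ = toMultiplier := by
  let _ := CStarAlgebra.spectralOrder (DoubleCentralizer ℂ AlgP)
  let _ := CStarAlgebra.spectralOrderedRing (DoubleCentralizer ℂ AlgP)
  obtain ⟨q, hq, hqq, qh, qk, qx, qx'⟩ := exists_support_projection
  set j := toMultiplier
  have hq1 : star (1 - q) = 1 - q := by rw [star_sub, star_one, hq]
  have jsh : star (j h) = j h := by rw [← map_star, isPTriple.star_h]
  have jsk : star (j k) = j k := by rw [← map_star, isPTriple.star_k]
  have hq' : j h * q = j h := by
    have := congrArg star qh
    rwa [star_mul, hq, jsh] at this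
  have kq : j k * q = 0 := by
    have := congrArg star qk
    rwa [star_mul, hq, jsk, star_zero] at this
  have xq : j x * q = j x := by
    have := congrArg star qx'
    rwa [star_mul, hq, ← map_star, star_star] at this
  have xq' : j (star x) * q = 0 := by
    have := congrArg star qx
    rwa [star_mul, hq, ← map_star, star_zero] at this
  -- Relative to `q` this is the matrix with rows `(q - h, x⋆)` and `(x, k)`, the corners that `l`
  -- must have if `p` is sent to `q`.
  let a := q - j h + j x + j (star x) + j k
  have aq : a * q = q - j h + j x := by
    simp only [a, add_mul, sub_mul, hqq, hq', xq, xq', kq, add_zero]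
  have qa : q * a = q - j h + j (star x) := by
    simp only [a, mul_add, mul_sub, hqq, qh, qx, qx', qk, add_zero]
  have qaq : q * a * q = q - j h := by
    rw [qa, add_mul, sub_mul, hqq, hq', xq', add_zero]
  -- The extension of `j` to the unitization sends the added unit to the unit of the multiplier
  -- algebra.
  have hM := (isPTriple.zero_le_one).map (Unitization.starLift j)
  have lift_inr : ∀ b : AlgP, Unitization.starLift j (b : Unitization ℂ AlgP) = j b :=
    fun b => DFunLike.congr_fun (Unitization.starLift.symm_apply_apply j) b
  obtain ⟨⟨Y, hY⟩, ⟨Z, hZ⟩⟩ := hM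
  have ha : IsPosContraction a := by
    -- For the column `v = (q, 1 - q)` one has `v⋆v = 1`, so `a = v⋆Pv` and `1 - a = v⋆(1 - P)v`.
    refine isPosContraction_of_nonneg ?_ ?_
    · have h1 := compression_nonneg hY hq hq1
      simp only [relationMatrix, Matrix.map_apply, Matrix.of_apply, Matrix.cons_val',
        Matrix.cons_val_zero, Matrix.cons_val_one, Matrix.cons_val_fin_one, Fin.isValue, map_sub,
        map_one, lift_inr] at h1
      convert h1 using 1
      simp only [a, mul_sub, sub_mul, mul_one, one_mul, hqq, qh, hq', qx, xq, qx', xq', qk, kq,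
        zero_mul]
      abel
    · have h1 := compression_nonneg hZ hq hq1
      simp only [relationMatrix, Matrix.map_apply, Matrix.of_apply, Matrix.cons_val',
        Matrix.cons_val_zero, Matrix.cons_val_one, Matrix.cons_val_fin_one, Fin.isValue, map_sub,
        map_one, lift_inr, Matrix.sub_apply, Matrix.one_apply_eq, ne_eq, one_ne_zero,
        zero_ne_one, not_false_eq_true, Matrix.one_apply_ne] at h1
      convert h1 using 1
      simp only [a, mul_sub, sub_mul, mul_one, one_mul, mul_zero, hqq, qh, hq', qx, xq, qx', xq',
        qk, kq, zero_mul]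
      abel
  obtain ⟨Ψ, hΨp, hΨl⟩ := FreeProductCC₀.exists_hom hq hqq ha
  refine ⟨Ψ, fun θ eh ek ex => cstarGen_hom_ext PRep.generator (φ := Ψ.comp θ) fun g => ?_⟩
  fin_cases g
  · change Ψ (θ h) = j h
    rw [eh, map_sub, map_mul, map_mul, hΨp, hΨl, qaq, sub_sub_cancel]
  · change Ψ (θ k) = j k
    simp only [ek, map_sub, map_add, map_mul, hΨp, hΨl, qaq]
    rw [qa, aq]
    simp only [a]
    abel
  · change Ψ (θ x) = j x
    simp only [ex, map_sub, map_mul, hΨp, hΨl, qaq]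
    rw [aq]
    abel

end AlgP

/-! ### The range of `θ` is the kernel of `ρ` -/

namespace FreeProductCC₀

/-- Expanding the product removes the added unit, so that homomorphisms of the non-unital algebra
can be applied to the formula. -/
lemma corner_eq_iff {y : FreeProductCC₀} :
    (y : Unitization ℂ FreeProductCC₀) =
        (1 - (p : Unitization ℂ FreeProductCC₀)) * l * (1 - (p : Unitization ℂ FreeProductCC₀)) ↔
      y = l - p * l - l * p + p * l * p := by
  rw [← (Unitization.inr_injective (R := ℂ) (A := FreeProductCC₀)).eq_iff]
  simp only [Unitization.inr_add, Unitization.inr_sub, Unitization.inr_mul]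
  have e : (1 - (p : Unitization ℂ FreeProductCC₀)) * l *
      (1 - (p : Unitization ℂ FreeProductCC₀)) =
      (l : Unitization ℂ FreeProductCC₀) - p * l - l * p + p * l * p := by noncomm_ring
  rw [e]

lemma off_diagonal_eq_iff {y : FreeProductCC₀} :
    (y : Unitization ℂ FreeProductCC₀) = (1 - (p : Unitization ℂ FreeProductCC₀)) * l * p ↔
      y = l * p - p * l * p := by
  rw [← (Unitization.inr_injective (R := ℂ) (A := FreeProductCC₀)).eq_iff]
  simp only [Unitization.inr_sub, Unitization.inr_mul, sub_mul, one_mul]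

lemma exists_character : ∃ ρ : FreeProductCC₀ →⋆ₙₐ[ℂ] ℂ, ρ p = 1 ∧ ρ l = 1 :=
  exists_hom (star_one ℂ) (one_mul 1) ⟨⟨1, by simp⟩, by simp⟩

section Range

variable {θ : AlgP →⋆ₙₐ[ℂ] FreeProductCC₀}

lemma injective_of_generators (eh : θ AlgP.h = p - p * l * p)
    (ek : θ AlgP.k = l - p * l - l * p + p * l * p) (ex : θ AlgP.x = l * p - p * l * p) :
    Function.Injective θ := by
  obtain ⟨Ψ, hΨ⟩ := AlgP.exists_hom_multiplier
  have h1 := hΨ θ eh ek ex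
  intro a b hab
  refine DoubleCentralizer.coeHom_injective (A := AlgP) ?_
  have h2 := DFunLike.congr_fun h1 a
  have h3 := DFunLike.congr_fun h1 b
  rw [NonUnitalStarAlgHom.comp_apply] at h2 h3
  exact h2.symm.trans ((congrArg Ψ hab).trans h3)

lemma isClosed_range (hθ : Function.Injective θ) : IsClosed (Set.range θ) :=
  (NonUnitalStarAlgHom.isometry θ hθ).isClosedEmbedding.isClosed_range

/-- On images under `θ`, left multiplication by `p` fixes those of `h` and `x⋆` and kills those of
`k` and `x`, as the support projection does in the multipliers of `𝒫`. -/
lemma p_mul_mem_range (eh : θ AlgP.h = p - p * l * p)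
    (ek : θ AlgP.k = l - p * l - l * p + p * l * p) (ex : θ AlgP.x = l * p - p * l * p)
    (hcl : IsClosed (Set.range θ)) (a : AlgP) : p * θ a ∈ Set.range θ := by
  have hpp : ∀ b : FreeProductCC₀, p * (p * b) = p * b := fun b => by rw [← mul_assoc, p_mul_p]
  let R : Submodule ℂ AlgP :=
    { carrier := {a | p * θ a ∈ Set.range θ}
      add_mem' := by
        rintro a b ⟨a', ha⟩ ⟨b', hb⟩
        exact ⟨a' + b', by rw [map_add, map_add, mul_add, ha, hb]⟩
      zero_mem' := ⟨0, by rw [map_zero, mul_zero]⟩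
      smul_mem' := by
        rintro c a ⟨a', ha⟩
        exact ⟨c • a', by rw [map_smul, map_smul, mul_smul_comm, ha]⟩ }
  refine AlgP.mem_of_right_ideal (R := R)
    (hcl.preimage ((map_continuous θ).const_mul p)) ?_ ⟨AlgP.h, ?_⟩ ⟨0, ?_⟩ ⟨0, ?_⟩
    ⟨star AlgP.x, ?_⟩ a
  · rintro a b ⟨a', ha⟩
    exact ⟨a' * b, by rw [map_mul, map_mul, ← mul_assoc, ha]⟩
  · simp only [eh, mul_sub, mul_assoc, p_mul_p, hpp]
  · simp only [ek, mul_sub, mul_add, mul_assoc, hpp, map_zero]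
    abel
  · simp only [ex, mul_sub, mul_assoc, hpp, map_zero, sub_self]
  · simp only [map_star, ex, star_sub, star_mul, star_p, isPosContraction_l.isSelfAdjoint.star_eq,
      mul_sub, hpp]

/-- The elements `θ x`, `θ x⋆`, `θ k` are three corners of `l`, and the fourth is `plp = p - θ h`.
So `l` and `p` agree modulo the range. -/
lemma l_eq (eh : θ AlgP.h = p - p * l * p)
    (ek : θ AlgP.k = l - p * l - l * p + p * l * p) (ex : θ AlgP.x = l * p - p * l * p) :
    l = p + θ (-AlgP.h + AlgP.x + star AlgP.x + AlgP.k) := by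
  simp only [map_add, map_neg, map_star, eh, ek, ex, star_sub, star_mul, star_p,
    isPosContraction_l.isSelfAdjoint.star_eq, mul_assoc]
  abel

/-- The condition on `star b` makes the admissible `b` a `*`-subalgebra, so that `p` and `l`
suffice; `l` is handled by writing it as `p` plus an element of the range. Right multiplication
follows by adjoints, the range being `*`-invariant. -/
lemma mul_mem_range (eh : θ AlgP.h = p - p * l * p)
    (ek : θ AlgP.k = l - p * l - l * p + p * l * p) (ex : θ AlgP.x = l * p - p * l * p)
    (hcl : IsClosed (Set.range θ)) (b : FreeProductCC₀) :
    (∀ a, b * θ a ∈ Set.range θ) ∧ ∀ a, star b * θ a ∈ Set.range θ := by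
  let S : NonUnitalStarSubalgebra ℂ FreeProductCC₀ :=
    { carrier := {b | (∀ a, b * θ a ∈ Set.range θ) ∧ ∀ a, star b * θ a ∈ Set.range θ}
      add_mem' := by
        have key : ∀ {b c : FreeProductCC₀}, (∀ a, b * θ a ∈ Set.range θ) →
            (∀ a, c * θ a ∈ Set.range θ) → ∀ a, (b + c) * θ a ∈ Set.range θ := by
          intro b c hb hc a
          obtain ⟨b', hb'⟩ := hb a
          obtain ⟨c', hc'⟩ := hc a
          exact ⟨b' + c', by rw [map_add, add_mul, hb', hc']⟩
        intro b c hb hc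
        exact ⟨key hb.1 hc.1, by rw [star_add]; exact key hb.2 hc.2⟩
      zero_mem' := by
        have : ∀ a, 0 * θ a ∈ Set.range θ := fun a => ⟨0, by rw [map_zero, zero_mul]⟩
        exact ⟨this, by rwa [star_zero]⟩
      smul_mem' := by
        have key : ∀ (c : ℂ) {b : FreeProductCC₀}, (∀ a, b * θ a ∈ Set.range θ) →
            ∀ a, (c • b) * θ a ∈ Set.range θ := by
          intro c b hb a
          obtain ⟨b', hb'⟩ := hb a
          exact ⟨c • b', by rw [map_smul, smul_mul_assoc, hb']⟩
        intro c b hb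
        exact ⟨key c hb.1, by rw [star_smul]; exact key _ hb.2⟩
      mul_mem' := by
        have key : ∀ {b c : FreeProductCC₀}, (∀ a, b * θ a ∈ Set.range θ) →
            (∀ a, c * θ a ∈ Set.range θ) → ∀ a, (b * c) * θ a ∈ Set.range θ := by
          intro b c hb hc a
          obtain ⟨c', hc'⟩ := hc a
          rw [mul_assoc, ← hc']
          exact hb c'
        intro b c hb hc
        exact ⟨key hb.1 hc.1, by rw [star_mul]; exact key hc.2 hb.2⟩
      star_mem' := fun hb => ⟨hb.2, by rw [star_star]; exact hb.1⟩ }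
  have hS : IsClosed (S : Set FreeProductCC₀) := by
    have h1 : IsClosed {b : FreeProductCC₀ | ∀ a, b * θ a ∈ Set.range θ} := by
      simp only [Set.ofPred_forall]
      exact isClosed_iInter fun a => hcl.preimage (continuous_id.mul_const (θ a))
    exact h1.inter (h1.preimage continuous_star)
  have hp := p_mul_mem_range eh ek ex hcl
  have hl : ∀ a, l * θ a ∈ Set.range θ := by
    intro a
    obtain ⟨a', ha'⟩ := hp a
    refine ⟨a' + (-AlgP.h + AlgP.x + star AlgP.x + AlgP.k) * a, ?_⟩
    rw [map_add, map_mul, ha', ← add_mul, ← l_eq eh ek ex]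
  exact mem_of_generators_mem (S := S) hS ⟨hp, by rwa [star_p]⟩
    ⟨hl, by rwa [isPosContraction_l.isSelfAdjoint.star_eq]⟩ b

lemma sub_smul_mem_range (eh : θ AlgP.h = p - p * l * p)
    (ek : θ AlgP.k = l - p * l - l * p + p * l * p) (ex : θ AlgP.x = l * p - p * l * p)
    (hcl : IsClosed (Set.range θ)) {ρ : FreeProductCC₀ →⋆ₙₐ[ℂ] ℂ} (hp : ρ p = 1) (hl : ρ l = 1)
    (b : FreeProductCC₀) : b - ρ b • p ∈ Set.range θ := by
  let S : NonUnitalStarSubalgebra ℂ FreeProductCC₀ :=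
    { carrier := {b | b - ρ b • p ∈ Set.range θ}
      add_mem' := by
        rintro b c ⟨b', hb⟩ ⟨c', hc⟩
        refine ⟨b' + c', ?_⟩
        rw [map_add, hb, hc, map_add, add_smul]
        abel
      zero_mem' := ⟨0, by rw [map_zero, map_zero, zero_smul, sub_zero]⟩
      smul_mem' := by
        rintro c b ⟨b', hb⟩
        exact ⟨c • b', by rw [map_smul, map_smul, hb, smul_sub, smul_assoc]⟩
      mul_mem' := by
        rintro b c ⟨b', hb⟩ ⟨c', hc⟩
        obtain ⟨d, hd⟩ := (mul_mem_range eh ek ex hcl b).1 c'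
        obtain ⟨e, he⟩ := (mul_mem_range eh ek ex hcl p).1 (star b')
        -- `bc - ρ(bc)p = b(c - ρ(c)p) + ρ(c)(b - ρ(b)p)p`, where right multiplication by `p` is
        -- obtained from left multiplication by taking adjoints.
        refine ⟨d + ρ c • star e, ?_⟩
        have he' : star (θ e) = θ b' * p := by
          rw [he, star_mul, map_star, star_star, star_p]
        rw [map_add, map_smul, map_star, he', hd, hb, hc, map_mul, mul_sub, sub_mul, smul_sub,
          mul_smul_comm, smul_mul_assoc, p_mul_p, smul_smul, mul_comm (ρ c)]
        abel
      star_mem' := by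
        rintro b ⟨b', hb⟩
        exact ⟨star b', by rw [map_star, map_star, hb, star_sub, star_smul, star_p]⟩ }
  refine mem_of_generators_mem (S := S) ?_ ⟨0, ?_⟩
    ⟨-AlgP.h + AlgP.x + star AlgP.x + AlgP.k, ?_⟩ b
  · exact hcl.preimage (continuous_id.sub ((map_continuous ρ).smul continuous_const))
  · rw [map_zero, hp, one_smul, sub_self]
  · rw [hl, one_smul, eq_sub_iff_add_eq', ← l_eq eh ek ex]

lemma comp_eq_zero (eh : θ AlgP.h = p - p * l * p)
    (ek : θ AlgP.k = l - p * l - l * p + p * l * p) (ex : θ AlgP.x = l * p - p * l * p)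
    {ρ : FreeProductCC₀ →⋆ₙₐ[ℂ] ℂ} (hp : ρ p = 1) (hl : ρ l = 1) (a : AlgP) : ρ (θ a) = 0 := by
  have h0 : ρ.comp θ = 0 := by
    refine cstarGen_hom_ext PRep.generator (φ := ρ.comp θ) fun g => ?_
    fin_cases g
    · change ρ (θ AlgP.h) = 0
      simp [eh, hp, hl]
    · change ρ (θ AlgP.k) = 0
      simp [ek, hp, hl]
    · change ρ (θ AlgP.x) = 0
      simp [ex, hp, hl]
  exact DFunLike.congr_fun h0 a

end Range

end FreeProductCC₀

/-! ### The exact sequence -/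

theorem theorem3p3 :
    (∃! θ : AlgP →⋆ₙₐ[ℂ] FreeProductCC₀,
      θ AlgP.h = FreeProductCC₀.p - FreeProductCC₀.p * FreeProductCC₀.l * FreeProductCC₀.p ∧
      (θ AlgP.k : Unitization ℂ FreeProductCC₀) =
        (1 - (FreeProductCC₀.p : Unitization ℂ FreeProductCC₀)) * FreeProductCC₀.l *
          (1 - (FreeProductCC₀.p : Unitization ℂ FreeProductCC₀)) ∧
      (θ AlgP.x : Unitization ℂ FreeProductCC₀) =
        (1 - (FreeProductCC₀.p : Unitization ℂ FreeProductCC₀)) * FreeProductCC₀.l *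
          FreeProductCC₀.p) ∧
    (∃! ρ : FreeProductCC₀ →⋆ₙₐ[ℂ] ℂ, ρ FreeProductCC₀.p = 1 ∧ ρ FreeProductCC₀.l = 1) ∧
    ∀ (θ : AlgP →⋆ₙₐ[ℂ] FreeProductCC₀) (ρ : FreeProductCC₀ →⋆ₙₐ[ℂ] ℂ),
      θ AlgP.h = FreeProductCC₀.p - FreeProductCC₀.p * FreeProductCC₀.l * FreeProductCC₀.p →
      (θ AlgP.k : Unitization ℂ FreeProductCC₀) =
        (1 - (FreeProductCC₀.p : Unitization ℂ FreeProductCC₀)) * FreeProductCC₀.l *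
          (1 - (FreeProductCC₀.p : Unitization ℂ FreeProductCC₀)) →
      (θ AlgP.x : Unitization ℂ FreeProductCC₀) =
        (1 - (FreeProductCC₀.p : Unitization ℂ FreeProductCC₀)) * FreeProductCC₀.l *
          FreeProductCC₀.p →
      ρ FreeProductCC₀.p = 1 → ρ FreeProductCC₀.l = 1 →
      Function.Injective θ ∧
      (∀ b : FreeProductCC₀, ρ b = 0 ↔ b ∈ Set.range θ) ∧
      Function.Surjective ρ ∧
      IsClosed (Set.range θ) ∧
      ∃ I : TwoSidedIdeal FreeProductCC₀, (I : Set FreeProductCC₀) = Set.range θ := by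
  refine ⟨?_, ?_, ?_⟩
  · obtain ⟨θ, ⟨eh, ek, ex⟩, huniq⟩ := AlgP.existsUnique_hom
      (isPTriple_of_projection FreeProductCC₀.star_p FreeProductCC₀.p_mul_p
        FreeProductCC₀.isPosContraction_l rfl (FreeProductCC₀.corner_eq_iff.2 rfl)
        (FreeProductCC₀.off_diagonal_eq_iff.2 rfl))
    refine ⟨θ, ⟨eh, FreeProductCC₀.corner_eq_iff.2 ek, FreeProductCC₀.off_diagonal_eq_iff.2 ex⟩,
      ?_⟩
    rintro θ' ⟨eh', ek', ex'⟩
    exact huniq θ'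
      ⟨eh', FreeProductCC₀.corner_eq_iff.1 ek', FreeProductCC₀.off_diagonal_eq_iff.1 ex'⟩
  · obtain ⟨ρ, hp, hl⟩ := FreeProductCC₀.exists_character
    exact ⟨ρ, ⟨hp, hl⟩, fun ρ' h =>
      FreeProductCC₀.hom_ext (h.1.trans hp.symm) (h.2.trans hl.symm)⟩
  · intro θ ρ eh ek ex hp hl
    replace ek := FreeProductCC₀.corner_eq_iff.1 ek
    replace ex := FreeProductCC₀.off_diagonal_eq_iff.1 ex
    have hinj := FreeProductCC₀.injective_of_generators eh ek ex
    have hcl := FreeProductCC₀.isClosed_range hinj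
    have hker : ∀ b, ρ b = 0 ↔ b ∈ Set.range θ := by
      intro b
      constructor
      · intro hb
        have h := FreeProductCC₀.sub_smul_mem_range eh ek ex hcl hp hl b
        rwa [hb, zero_smul, sub_zero] at h
      · rintro ⟨a, rfl⟩
        exact FreeProductCC₀.comp_eq_zero eh ek ex hp hl a
    -- The ideal is the kernel of `ρ`, already identified with the range of `θ`.
    refine ⟨hinj, hker, fun c => ⟨c • FreeProductCC₀.p, ?_⟩, hcl, TwoSidedIdeal.ker ρ, ?_⟩
    · rw [map_smul, hp, smul_eq_mul, mul_one]
    · ext b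
      rw [SetLike.mem_coe, TwoSidedIdeal.mem_ker]
      exact hker b
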